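/- **Setting.** Let $x_1,\dots,x_n$ be i.i.d. random vectors in $\mathbb R^d$ that are $\kappa$-subgaussian, $\kappa>0$, i.e. $\mathbb E\exp(\langle u,x_i\rangle^2/\kappa^2)\le 2$ for every unit vector $u$, and let $\Sigma=\mathbb E[x_ix_i^{\top}]$. Let $y_i=\langle x_i,\theta^*\rangle+\varepsilon_i$, where the noise vector $\varepsilon$ is independent of the features, $\mathbb E[\varepsilon]=0$ and $\mathbb E[\varepsilon\varepsilon^{\top}]=\sigma^2I_n$. Let $X\in\mathbb R^{n\times d}$ be the matrix with rows $x_i^{\top}$. For a partition of the $n$ samples into nonempty bags $B_1,\dots,B_m$ let $S\in\mathbb R^{m\times n}$ be the bagging matrix, $S_{\ell i}=|B_\ell|^{-1/2}$ if $i\in B_\ell$ and $S_{\ell i}=0$ otherwise, and let $\bar y_\ell$ be the mean of $y_i$ over $i\in B_\ell$. Let $\hat\theta$ be a (measurable) minimizer of the event-level loss $\theta\mapsto\frac1n\sum_{\ell=1}^m\sum_{i\in B_\ell}(\bar y_\ell-\langle x_i,\theta\rangle)^2$. For $k\ge1$, the bags are *optimally curated* from the true means $\mu=X\theta^*$: as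 a measurable function of $X$, they almost surely either minimize $\sum_\ell\sum_{i\in B_\ell}(\mu_i-\bar\mu_\ell)^2$, where $\bar\mu_\ell$ is the mean of $\mu_i$ over $i\in B_\ell$, over all partitions of the samples (with any number of bags) whose bags have size at least $k$; or they are obtained by sorting the samples by $\mu_i$ and cutting them into consecutive bags of size exactly $k$. **Theorem.** For every $\kappa>0$ there are constants $c,C>0$ depending only on $\kappa$ such that, in the above setting and whenever $n\sigma_{\min}(\Sigma)>C\sqrt{dn}$, there is an event of probability at least $1-\frac1n-2e^{-cd}$ on which $X^{\top}X$ is invertible, the bias term satisfies $$\big\|(X^{\top}X)^{-1}X^{\top}(S^{\top}S-I_n)X\theta^*\big\|^2\le\frac{8k\kappa^2\|\theta^*\|^2\log n}{n\sigma_{\min}(\Sigma)-C\sqrt{dn}},$$ and the risk satisfies $$\mathbb E\big[\|\hat\theta-\theta^*\|^2\,\big|\,X\big]\le\frac{8k\kappa^2\|\theta^*\|^2\log n}{n\sigma_{\min}(\Sigma)-C\sqrt{dn}}+\frac{\sigma^2\min(m,d)}{n\sigma_{\min}(\Sigma)-C\sqrt{dn}}.$$ Moreover the right-hand side does not grow with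 $n$: if $d$, $k$, $\sigma$, $\|\theta^*\|$ and $\sigma_{\min}(\Sigma)>0$ are held fixed, then it tends to $0$ as $n\to\infty$, whatever the number $m=m(n)$ of bags. -/

import Mathlib

open MeasureTheory ProbabilityTheory Filter Topology

noncomputable section

/-- A probability law `ν` on `ℝ^d` is `κ`-subgaussian if every one-dimensional marginal
`⟪u, x⟫` along a unit vector `u` satisfies `E exp (⟪u, x⟫² / κ²) ≤ 2`. -/
def IsSubgaussianLaw {d : ℕ} (κ : ℝ) (ν : Measure (EuclideanSpace ℝ (Fin d))) : Prop :=
  ∀ u : EuclideanSpace ℝ (Fin d), ‖u‖ = 1 →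
    ∫⁻ x, ENNReal.ofReal (Real.exp ((inner ℝ u x) ^ 2 / κ ^ 2)) ∂ν ≤ 2

/-- The matrix `Σ = E [x xᵀ]` of a law on `ℝ^d`. -/
def featureCov {d : ℕ} (ν : Measure (EuclideanSpace ℝ (Fin d))) : Matrix (Fin d) (Fin d) ℝ :=
  Matrix.of fun a b => ∫ x, x a * x b ∂ν

/-- The smallest of the `d` singular values of a `d × d` matrix (the singular values
are listed in decreasing order, starting at index `0`). -/
def sigmaMin {d : ℕ} (A : Matrix (Fin d) (Fin d) ℝ) : ℝ :=
  (Matrix.toEuclideanLin A).singularValues (d - 1)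

/-- A partition of the `n` samples into nonempty, non-overlapping bags. -/
abbrev Bagging (n : ℕ) : Type := Finpartition (Finset.univ : Finset (Fin n))

/-- The average of `y` over the bag `B`. -/
def bagMean {n : ℕ} (y : Fin n → ℝ) (B : Finset (Fin n)) : ℝ :=
  (∑ i ∈ B, y i) / (B.card : ℝ)

/-- The one-dimensional `k`-means objective of a bagging. -/
def baggingCost {n : ℕ} (y : Fin n → ℝ) (𝓑 : Bagging n) : ℝ :=
  ∑ B ∈ 𝓑.parts, ∑ i ∈ B, (y i - bagMean y B) ^ 2

/-- Every bag has at least `k` members. -/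
def HasMinBagSize {n : ℕ} (k : ℕ) (𝓑 : Bagging n) : Prop :=
  ∀ B ∈ 𝓑.parts, k ≤ B.card

/-- The bagging solves the size-constrained one-dimensional `k`-means problem for `y`: it minimizes
the objective among all baggings whose bags have at least `k` members. -/
def IsOptimalBagging {n : ℕ} (k : ℕ) (y : Fin n → ℝ) (𝓑 : Bagging n) : Prop :=
  HasMinBagSize k 𝓑 ∧ ∀ 𝓑' : Bagging n, HasMinBagSize k 𝓑' → baggingCost y 𝓑 ≤ baggingCost y 𝓑'

/-- The bagging cuts the samples, sorted by their `y`-values (ties broken in any way), into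
consecutive bags with exactly `k` members each. -/
def IsSortedBagging {n : ℕ} (k : ℕ) (y : Fin n → ℝ) (𝓑 : Bagging n) : Prop :=
  (∀ B ∈ 𝓑.parts, B.card = k) ∧
  ∀ A ∈ 𝓑.parts, ∀ B ∈ 𝓑.parts, A ≠ B →
    (∀ i ∈ A, ∀ j ∈ B, y i ≤ y j) ∨ (∀ i ∈ A, ∀ j ∈ B, y j ≤ y i)

/-- The `m × n` bagging matrix `S`, with `S_{ℓ i} = 1 / √|B_ℓ|` if sample `i` lies in the bag `B_ℓ`
and `0` otherwise; the bags themselves serve as the row indices. -/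
def bagMatrix {n : ℕ} (𝓑 : Bagging n) : Matrix 𝓑.parts (Fin n) ℝ :=
  Matrix.of fun B i => if i ∈ (B : Finset (Fin n)) then 1 / √((B : Finset (Fin n)).card : ℝ) else 0

/-- The `n × d` matrix whose rows are the feature vectors. -/
def designMatrix {n d : ℕ} (x : Fin n → EuclideanSpace ℝ (Fin d)) : Matrix (Fin n) (Fin d) ℝ :=
  Matrix.of fun i a => x i a

/-- The event-level squared loss
`(1/n) ∑_ℓ ∑_{i ∈ B_ℓ} (ȳ_ℓ - ⟪x_i, θ⟫)²`, in which only the bag averages of `y` appear. -/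
def eventLoss {n d : ℕ} (𝓑 : Bagging n) (x : Fin n → EuclideanSpace ℝ (Fin d)) (y : Fin n → ℝ)
    (θ : EuclideanSpace ℝ (Fin d)) : ℝ :=
  1 / (n : ℝ) * ∑ B ∈ 𝓑.parts, ∑ i ∈ B, (bagMean y B - inner ℝ (x i) θ) ^ 2

/-- The bias term `‖(XᵀX)⁻¹ Xᵀ (SᵀS - I) X θ‖²` of the estimation risk. -/
def biasTerm {n d : ℕ} (𝓑 : Bagging n) (x : Fin n → EuclideanSpace ℝ (Fin d))
    (θ : EuclideanSpace ℝ (Fin d)) : ℝ :=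
  let X := designMatrix x
  let S := bagMatrix 𝓑
  ‖WithLp.toLp 2 (((X.transpose * X)⁻¹ * X.transpose * (S.transpose * S - 1) * X).mulVec
    (θ : Fin d → ℝ))‖ ^ 2

/-- `(8 k κ² t² log n) / (n s - C √(d n))`, where `t` stands for `‖θ*‖` and `s` for `σ_min(Σ)`. -/
def biasBound (C κ s t : ℝ) (d k n : ℕ) : ℝ :=
  8 * k * κ ^ 2 * t ^ 2 * Real.log n / (n * s - C * √((d : ℝ) * n))

/-- `(σ² min(m, d)) / (n s - C √(d n))`, where `s` stands for `σ_min(Σ)`. -/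
def varianceBound (C σ s : ℝ) (d m n : ℕ) : ℝ :=
  σ ^ 2 * (min m d : ℕ) / (n * s - C * √((d : ℝ) * n))

end

/-!
The estimator regresses the bag averages `SᵀS y` on `X`. Once `XᵀX ≥ l` for some `l > 0`, it equals
`(XᵀX)⁻¹ Xᵀ SᵀS y`, and its error splits into the bias `(XᵀX)⁻¹ Xᵀ (SᵀS - I) X θ*` and the noise
term `(XᵀX)⁻¹ Xᵀ SᵀS ε` (`sub_eq_biasVec_add_noise`). Since `(XᵀX)⁻¹ Xᵀ` has norm at most `1 / √l`,

* the squared bias is at most `l⁻¹` times the within-bag sum of squares of the true means, that is,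
  the cost of the bagging (`biasTerm_le_baggingCost_div`);
* freezing the features, which are independent of the noise, the conditional variance is `σ²` times
  the squared Frobenius norm of `(XᵀX)⁻¹ Xᵀ Sᵀ`, a `d × m` matrix, hence at most `σ² min(m, d) / l`
  (`sum_noiseMatrix_sq_le`, `ae_condLExp_norm_sub_sq_le`).

The cost of a curated bagging is at most `2 k M²` with `M` the largest absolute mean
(`baggingCost_le_of_curated`): consecutive bags have non-overlapping ranges inside `[-M, M]`, so the
squared ranges add up to at most `4 M²`, and an optimal bagging is no worse than the sorted bagging
with sizes between `k` and `2 k`. By subgaussianity `M² ≤ 4 κ² ‖θ*‖² log n` outside an event of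
probability `1 / n` (`measureReal_exists_inner_sq_gt_le`).

It remains to take `l = n σ_min(Σ) - C √(d n)`. The squared marginals `⟪u, x_i⟫²` are
subexponential, so Bernstein's inequality bounds the deviation of the quadratic form of
`XᵀX - n Σ` at each point of a `1/2`-net of the unit sphere with at most `5 ^ d` points, and the
bound on the net extends to the sphere (`abs_inner_le_of_forall_net`). The assumption
`C √(d n) < n σ_min(Σ)`, together with `σ_min(Σ) ≤ κ²`, keeps the deviation within the Gaussian range
of Bernstein's inequality (`exists_measurableSet_design_bounded_below`).
-/

/-! ### Moments and exponential moments of squared subgaussian marginals -/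

lemma exp_le_one_add_add_sq_mul_exp_abs (x : ℝ) :
    Real.exp x ≤ 1 + x + x ^ 2 * Real.exp |x| := by
  have h := Complex.norm_exp_sub_sum_le_norm_mul_exp (x : ℂ) 2
  have h2 : ‖(Complex.exp (x : ℂ) - ∑ m ∈ Finset.range 2, (x : ℂ) ^ m / (m.factorial : ℂ))‖
      = |Real.exp x - (1 + x)| := by
    have : (Complex.exp (x : ℂ) - ∑ m ∈ Finset.range 2, (x : ℂ) ^ m / (m.factorial : ℂ))
        = ((Real.exp x - (1 + x) : ℝ) : ℂ) := by
      simp [Finset.sum_range_succ]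
    rw [this, Complex.norm_real, Real.norm_eq_abs]
  rw [h2, Complex.norm_real, Real.norm_eq_abs, sq_abs] at h
  linarith [le_abs_self (Real.exp x - (1 + x))]

lemma sq_mul_exp_half_le (w : ℝ) (hw : 0 ≤ w) : w ^ 2 * Real.exp (w / 2) ≤ 8 * Real.exp w := by
  have h1 : w ^ 2 ≤ 8 * Real.exp (w / 2) := by
    nlinarith [Real.quadratic_le_exp_of_nonneg (x := w / 2) (by positivity)]
  calc w ^ 2 * Real.exp (w / 2) ≤ 8 * Real.exp (w / 2) * Real.exp (w / 2) := by gcongr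
    _ = 8 * Real.exp w := by rw [mul_assoc, ← Real.exp_add]; ring_nf

section Moments

variable {Ω : Type*} {mΩ : MeasurableSpace Ω} {μ : Measure Ω} {Z : Ω → ℝ} {K : ℝ}

lemma integrable_exp_div (hZ : Measurable Z)
    (h : ∫⁻ ω, ENNReal.ofReal (Real.exp (Z ω / K)) ∂μ ≤ 2) :
    Integrable (fun ω => Real.exp (Z ω / K)) μ := by
  refine ⟨by fun_prop, ?_⟩
  rw [hasFiniteIntegral_iff_ofReal (ae_of_all _ fun ω => (Real.exp_pos _).le)]
  exact h.trans_lt (by simp)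

lemma integral_exp_div_le (hZ : Measurable Z)
    (h : ∫⁻ ω, ENNReal.ofReal (Real.exp (Z ω / K)) ∂μ ≤ 2) :
    ∫ ω, Real.exp (Z ω / K) ∂μ ≤ 2 := by
  rw [integral_eq_lintegral_of_nonneg_ae (ae_of_all _ fun ω => (Real.exp_pos _).le) (by fun_prop)]
  simpa using ENNReal.toReal_mono (by simp) h

lemma integrable_of_lintegral_exp_div (hK : 0 < K) (hZ : Measurable Z) (hZ0 : ∀ ω, 0 ≤ Z ω)
    (h : ∫⁻ ω, ENNReal.ofReal (Real.exp (Z ω / K)) ∂μ ≤ 2) : Integrable Z μ := by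
  refine ((integrable_exp_div hZ h).const_mul K).mono' hZ.aestronglyMeasurable (ae_of_all _ ?_)
  intro ω
  rw [Real.norm_eq_abs, abs_of_nonneg (hZ0 ω)]
  calc Z ω = K * (Z ω / K) := by field_simp
    _ ≤ K * Real.exp (Z ω / K) := by gcongr; linarith [Real.add_one_le_exp (Z ω / K)]

variable [IsProbabilityMeasure μ]

lemma integral_le_of_lintegral_exp_div (hK : 0 < K) (hZ : Measurable Z) (hZ0 : ∀ ω, 0 ≤ Z ω)
    (h : ∫⁻ ω, ENNReal.ofReal (Real.exp (Z ω / K)) ∂μ ≤ 2) : ∫ ω, Z ω ∂μ ≤ K := by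
  have h1 : ∫ ω, Z ω ∂μ ≤ ∫ ω, (K * Real.exp (Z ω / K) - K) ∂μ := by
    refine integral_mono (integrable_of_lintegral_exp_div hK hZ hZ0 h)
      (((integrable_exp_div hZ h).const_mul K).sub (integrable_const _)) fun ω => ?_
    have : Z ω = K * (Z ω / K) := by field_simp
    have := Real.add_one_le_exp (Z ω / K)
    show Z ω ≤ K * Real.exp (Z ω / K) - K
    nlinarith
  rw [integral_sub ((integrable_exp_div hZ h).const_mul K) (integrable_const _),
    integral_const_mul] at h1
  simp only [integral_const, probReal_univ, smul_eq_mul, one_mul] at h1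
  nlinarith [integral_exp_div_le hZ h]

/-- The second-order Taylor bound on the exponential whose remainder is controlled by the
exponential moment `exp (z / K)`. -/
lemma exp_mul_le_of_abs_le {z l : ℝ} (hK : 0 < K) (hz : 0 ≤ z) (hl : |l| ≤ 1 / (2 * K)) :
    Real.exp (l * z) ≤ 1 + l * z + 8 * l ^ 2 * K ^ 2 * Real.exp (z / K) := by
  refine (exp_le_one_add_add_sq_mul_exp_abs _).trans ?_
  have h1 : |l * z| ≤ z / K / 2 := by
    rw [abs_mul, abs_of_nonneg hz]
    calc |l| * z ≤ 1 / (2 * K) * z := by gcongr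
      _ = z / K / 2 := by field_simp
  have h2 := sq_mul_exp_half_le (z / K) (by positivity)
  have h3 : (l * z) ^ 2 = l ^ 2 * K ^ 2 * (z / K) ^ 2 := by field_simp
  have h4 : (l * z) ^ 2 * Real.exp |l * z| ≤ l ^ 2 * K ^ 2 * (8 * Real.exp (z / K)) := by
    calc (l * z) ^ 2 * Real.exp |l * z| ≤ (l * z) ^ 2 * Real.exp (z / K / 2) := by gcongr
      _ = l ^ 2 * K ^ 2 * ((z / K) ^ 2 * Real.exp (z / K / 2)) := by rw [h3]; ring
      _ ≤ _ := by gcongr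
  linarith

lemma integrable_exp_mul_of_abs_le {l : ℝ} (hK : 0 < K) (hZ : Measurable Z) (hZ0 : ∀ ω, 0 ≤ Z ω)
    (h : ∫⁻ ω, ENNReal.ofReal (Real.exp (Z ω / K)) ∂μ ≤ 2) (hl : |l| ≤ 1 / (2 * K)) :
    Integrable (fun ω => Real.exp (l * Z ω)) μ := by
  refine (((integrable_const 1).add ((integrable_of_lintegral_exp_div hK hZ hZ0 h).const_mul l)).add
    ((integrable_exp_div hZ h).const_mul (8 * l ^ 2 * K ^ 2))).mono' (by fun_prop)
    (ae_of_all _ fun ω => ?_)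
  rw [Real.norm_eq_abs, abs_of_pos (Real.exp_pos _)]
  exact exp_mul_le_of_abs_le hK (hZ0 ω) hl

lemma integrable_exp_mul_sub_integral {l : ℝ} (hK : 0 < K) (hZ : Measurable Z)
    (hZ0 : ∀ ω, 0 ≤ Z ω)
    (h : ∫⁻ ω, ENNReal.ofReal (Real.exp (Z ω / K)) ∂μ ≤ 2) (hl : |l| ≤ 1 / (2 * K)) (a : ℝ) :
    Integrable (fun ω => Real.exp (l * (Z ω - a))) μ := by
  have := (integrable_exp_mul_of_abs_le hK hZ hZ0 h hl).const_mul (Real.exp (-(l * a)))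
  refine this.congr (ae_of_all _ fun ω => ?_)
  simp only [← Real.exp_add]
  ring_nf

/-- A nonnegative variable with `E exp (Z / K) ≤ 2` is subexponential after centering. -/
lemma mgf_sub_integral_le {l : ℝ} (hK : 0 < K) (hZ : Measurable Z) (hZ0 : ∀ ω, 0 ≤ Z ω)
    (h : ∫⁻ ω, ENNReal.ofReal (Real.exp (Z ω / K)) ∂μ ≤ 2) (hl : |l| ≤ 1 / (2 * K)) :
    mgf (fun ω => Z ω - ∫ ω', Z ω' ∂μ) μ l ≤ Real.exp (16 * l ^ 2 * K ^ 2) := by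
  have hi := integrable_of_lintegral_exp_div hK hZ hZ0 h
  have he := integrable_exp_div hZ h
  set a := ∫ ω', Z ω' ∂μ with ha
  have h1 : ∫ ω, Real.exp (l * Z ω) ∂μ ≤ Real.exp (l * a + 16 * l ^ 2 * K ^ 2) := by
    have h2 : ∫ ω, Real.exp (l * Z ω) ∂μ ≤
        ∫ ω, (1 + l * Z ω + 8 * l ^ 2 * K ^ 2 * Real.exp (Z ω / K)) ∂μ :=
      integral_mono (integrable_exp_mul_of_abs_le hK hZ hZ0 h hl)
        (((integrable_const 1).add (hi.const_mul l)).add (he.const_mul _))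
        fun ω => exp_mul_le_of_abs_le hK (hZ0 ω) hl
    rw [integral_add (f := fun ω => 1 + l * Z ω) ((integrable_const 1).add (hi.const_mul l))
        (he.const_mul _),
      integral_add (integrable_const 1) (hi.const_mul l), integral_const_mul,
      integral_const_mul] at h2
    simp only [integral_const, probReal_univ, smul_eq_mul, one_mul, ← ha] at h2
    have h3 : 8 * l ^ 2 * K ^ 2 * ∫ ω, Real.exp (Z ω / K) ∂μ ≤ 8 * l ^ 2 * K ^ 2 * 2 := by
      gcongr
      exact integral_exp_div_le hZ h
    linarith [Real.add_one_le_exp (l * a + 16 * l ^ 2 * K ^ 2)]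
  calc mgf (fun ω => Z ω - a) μ l = Real.exp (-(l * a)) * ∫ ω, Real.exp (l * Z ω) ∂μ := by
        rw [mgf, ← integral_const_mul]
        congr 1 with ω
        rw [← Real.exp_add]; ring_nf
    _ ≤ Real.exp (-(l * a)) * Real.exp (l * a + 16 * l ^ 2 * K ^ 2) := by gcongr
    _ = _ := by rw [← Real.exp_add]; ring_nf

lemma measureReal_lt_le_of_lintegral_exp_div (hZ : Measurable Z)
    (h : ∫⁻ ω, ENNReal.ofReal (Real.exp (Z ω / K)) ∂μ ≤ 2) (hK : 0 < K) (t : ℝ) :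
    μ.real {ω | K * t < Z ω} ≤ 2 * Real.exp (-t) := by
  have h1 := mul_meas_ge_le_integral_of_nonneg (μ := μ)
    (ae_of_all _ fun ω => (Real.exp_pos (Z ω / K)).le) (integrable_exp_div hZ h) (Real.exp t)
  have h2 : μ.real {ω | K * t < Z ω} ≤ μ.real {ω | Real.exp t ≤ Real.exp (Z ω / K)} := by
    refine measureReal_mono fun ω hω => ?_
    simp only [Set.mem_ofPred_eq, Real.exp_le_exp] at hω ⊢
    rw [le_div_iff₀ hK]; linarith
  rw [Real.exp_neg, ← div_eq_mul_inv, le_div_iff₀ (Real.exp_pos _)]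
  nlinarith [integral_exp_div_le hZ h, Real.exp_pos t]

/-- Bernstein's inequality, in the range of deviations where the tail is Gaussian. -/
lemma measureReal_abs_sum_ge_le {n : ℕ} {Z : Fin n → Ω → ℝ} (hn : 0 < n) (hK : 0 < K)
    (hZ : ∀ i, Measurable (Z i)) (hZ0 : ∀ i ω, 0 ≤ Z i ω)
    (h : ∀ i, ∫⁻ ω, ENNReal.ofReal (Real.exp (Z i ω / K)) ∂μ ≤ 2) (hind : iIndepFun Z μ)
    {s : ℝ} (hs : 0 ≤ s) (hs' : s ≤ 16 * n * K) :
    μ.real {ω | s ≤ |∑ i, (Z i ω - ∫ ω', Z i ω' ∂μ)|} ≤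
      2 * Real.exp (-(s ^ 2 / (64 * n * K ^ 2))) := by
  have hn' : (0 : ℝ) < n := by exact_mod_cast hn
  set Y : Fin n → Ω → ℝ := fun i ω => Z i ω - ∫ ω', Z i ω' ∂μ with hY
  have hYm : ∀ i, Measurable (Y i) := fun i => (hZ i).sub_const _
  have hYind : iIndepFun Y μ :=
    hind.comp (fun i z => z - ∫ ω', Z i ω' ∂μ) fun i => measurable_id.sub_const _
  have hmgf : ∀ l : ℝ, |l| ≤ 1 / (2 * K) →
      mgf (∑ i, Y i) μ l ≤ Real.exp (16 * n * l ^ 2 * K ^ 2) := by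
    intro l hl
    rw [hYind.mgf_sum hYm]
    calc ∏ i, mgf (Y i) μ l ≤ ∏ _i : Fin n, Real.exp (16 * l ^ 2 * K ^ 2) :=
          Finset.prod_le_prod (fun i _ => mgf_nonneg)
            fun i _ => mgf_sub_integral_le hK (hZ i) (hZ0 i) (h i) hl
      _ = _ := by
          rw [Finset.prod_const, ← Real.exp_nat_mul]
          simp only [Finset.card_univ, Fintype.card_fin]
          ring_nf
  have hint : ∀ l : ℝ, |l| ≤ 1 / (2 * K) →
      Integrable (fun ω => Real.exp (l * (∑ i, Y i) ω)) μ := fun l hl =>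
    hYind.integrable_exp_mul_sum hYm fun i _ =>
      integrable_exp_mul_sub_integral hK (hZ i) (hZ0 i) (h i) hl _
  -- the optimal parameter in the Chernoff bound
  set l := s / (32 * n * K ^ 2) with hl
  have hl0 : 0 ≤ l := by positivity
  have hl1 : |l| ≤ 1 / (2 * K) := by
    rw [abs_of_nonneg hl0, hl, div_le_div_iff₀ (by positivity) (by positivity)]
    nlinarith
  have hexp : -l * s + 16 * n * l ^ 2 * K ^ 2 = -(s ^ 2 / (64 * n * K ^ 2)) := by
    rw [hl]; field_simp; ring
  have hup : μ.real {ω | s ≤ (∑ i, Y i) ω} ≤ Real.exp (-(s ^ 2 / (64 * n * K ^ 2))) := by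
    refine (measure_ge_le_exp_mul_mgf s hl0 (hint l hl1)).trans ?_
    rw [← hexp, Real.exp_add]
    gcongr
    exact hmgf l hl1
  have hlow : μ.real {ω | (∑ i, Y i) ω ≤ -s} ≤ Real.exp (-(s ^ 2 / (64 * n * K ^ 2))) := by
    have hl1' : |-l| ≤ 1 / (2 * K) := by rwa [abs_neg]
    refine (measure_le_le_exp_mul_mgf (-s) (neg_nonpos.2 hl0) (hint (-l) hl1')).trans ?_
    rw [← hexp, Real.exp_add]
    have := hmgf (-l) hl1'
    rw [neg_sq] at this
    have e : - -l * -s = -l * s := by ring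
    rw [e]
    gcongr
  calc μ.real {ω | s ≤ |∑ i, (Z i ω - ∫ ω', Z i ω' ∂μ)|}
      ≤ μ.real ({ω | s ≤ (∑ i, Y i) ω} ∪ {ω | (∑ i, Y i) ω ≤ -s}) := by
        refine measureReal_mono fun ω hω => ?_
        simp only [Set.mem_ofPred_eq, Set.mem_union, Finset.sum_apply, hY, le_abs] at hω ⊢
        exact hω.imp id fun h => by linarith
    _ ≤ _ := measureReal_union_le _ _
    _ ≤ _ := by linarith

end Moments

/-! ### A net of the unit sphere and quadratic forms -/

section Net

variable {E : Type*} [NormedAddCommGroup E] [InnerProductSpace ℝ E] [FiniteDimensional ℝ E]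

/-- The unit sphere of a `d`-dimensional space has a `1/2`-net with at most `5 ^ d` elements:
a maximal `1/2`-separated subset. -/
lemma exists_half_net_unitSphere :
    ∃ N : Finset E, (∀ u ∈ N, ‖u‖ = 1) ∧ N.card ≤ 5 ^ Module.finrank ℝ E ∧
      ∀ v : E, ‖v‖ = 1 → ∃ u ∈ N, ‖v - u‖ ≤ 1 / 2 := by
  classical
  -- the possible sizes of `1/2`-separated subsets of the sphere
  let S : Set ℕ := {c | ∃ N : Finset E, N.card = c ∧ (∀ u ∈ N, ‖u‖ = 1) ∧
    ∀ u ∈ N, ∀ v ∈ N, u ≠ v → 1 / 2 ≤ ‖u - v‖}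
  have hS : ∀ c ∈ S, c ≤ 5 ^ Module.finrank ℝ E := by
    rintro c ⟨N, rfl, h1, h2⟩
    have hinj : Function.Injective fun u : E => (2 : ℝ) • u :=
      smul_right_injective E (two_ne_zero)
    rw [← Finset.card_image_of_injective N hinj]
    refine Besicovitch.card_le_of_separated _ ?_ ?_
    · simp only [Finset.mem_image, forall_exists_index, and_imp, forall_apply_eq_imp_iff₂]
      intro u hu
      simp [norm_smul, h1 u hu]
    · simp only [Finset.mem_image, forall_exists_index, and_imp, forall_apply_eq_imp_iff₂]
      intro u hu v hv huv
      rw [← smul_sub, norm_smul]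
      have := h2 u hu v hv (by rintro rfl; exact huv rfl)
      norm_num
      linarith
  have hne : S.Nonempty := ⟨0, ∅, by simp⟩
  have hbdd : BddAbove S := ⟨_, hS⟩
  obtain ⟨N, hNc, h1, h2⟩ := Nat.sSup_mem hne hbdd
  refine ⟨N, h1, hNc ▸ hS _ (Nat.sSup_mem hne hbdd), fun v hv => ?_⟩
  by_contra! hcon
  have hvN : v ∉ N := fun h => by have := hcon v h; simp at this; linarith
  have : (insert v N).card ∈ S := by
    refine ⟨_, rfl, ?_, ?_⟩
    · simpa [hv] using h1
    · intro a ha b hb hab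
      rw [Finset.mem_insert] at ha hb
      rcases ha with rfl | ha <;> rcases hb with rfl | hb
      · exact absurd rfl hab
      · exact (hcon b hb).le
      · rw [norm_sub_rev]; exact (hcon a ha).le
      · exact h2 a ha b hb hab
  have := le_csSup hbdd this
  rw [Finset.card_insert_of_notMem hvN, hNc] at this
  omega

/-- A quadratic form that is small on a `1/2`-net of the unit sphere is small everywhere.
For a unit vector `v` maximizing `|q|` and a net point `u` near it, `q v - q u` is, by
polarization, `(q (5v/2 - 3u/2) - q (3v/2 - 5u/2)) / 4`, which is at most `31/32` of the maximum. -/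
lemma abs_inner_le_of_forall_net (T : E →L[ℝ] E) {N : Finset E} (hN1 : ∀ u ∈ N, ‖u‖ = 1)
    (hN : ∀ v : E, ‖v‖ = 1 → ∃ u ∈ N, ‖v - u‖ ≤ 1 / 2) {s : ℝ}
    (hs : ∀ u ∈ N, |inner ℝ (T u) u| ≤ s) (v : E) :
    |inner ℝ (T v) v| ≤ 32 * s * ‖v‖ ^ 2 := by
  rcases eq_or_ne v 0 with rfl | hv
  · simp
  have hcpt : IsCompact (Metric.sphere (0 : E) 1) := isCompact_sphere 0 1
  have hne : (Metric.sphere (0 : E) 1).Nonempty :=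
    ⟨‖v‖⁻¹ • v, by simp [norm_smul, hv]⟩
  have hcont : Continuous fun w : E => |inner ℝ (T w) w| := by fun_prop
  obtain ⟨v₀, hv₀, hmax⟩ := hcpt.exists_isMaxOn hne hcont.continuousOn
  set M := |inner ℝ (T v₀) v₀| with hM
  have hbound : ∀ w : E, |inner ℝ (T w) w| ≤ M * ‖w‖ ^ 2 := by
    intro w
    rcases eq_or_ne w 0 with rfl | hw
    · simp
    have hw' : ‖w‖ ≠ 0 := norm_ne_zero_iff.2 hw
    have h := hmax (show ‖w‖⁻¹ • w ∈ Metric.sphere (0 : E) 1 by simp [norm_smul, hw])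
    simp only [Set.mem_ofPred_eq, map_smul, inner_smul_left, inner_smul_right, abs_mul] at h
    simp only [RCLike.conj_to_real, abs_inv, abs_norm] at h
    calc |inner ℝ (T w) w| = (‖w‖⁻¹ * (‖w‖⁻¹ * |inner ℝ (T w) w|)) * ‖w‖ ^ 2 := by field_simp
      _ ≤ M * ‖w‖ ^ 2 := by gcongr
  have hv1 : ‖v₀‖ = 1 := by simpa using hv₀
  obtain ⟨u, huN, hu⟩ := hN v₀ hv1
  have hu1 := hN1 u huN
  have hinner : 7 / 8 ≤ inner ℝ v₀ u := by
    have := norm_sub_sq_real v₀ u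
    rw [hv1, hu1] at this
    nlinarith [norm_nonneg (v₀ - u)]
  have key : 4 * (inner ℝ (T v₀) v₀ - inner ℝ (T u) u) =
      inner ℝ (T ((5 / 2 : ℝ) • v₀ - (3 / 2 : ℝ) • u)) ((5 / 2 : ℝ) • v₀ - (3 / 2 : ℝ) • u) -
      inner ℝ (T ((3 / 2 : ℝ) • v₀ - (5 / 2 : ℝ) • u)) ((3 / 2 : ℝ) • v₀ - (5 / 2 : ℝ) • u) := by
    simp only [map_sub, map_smul, inner_sub_left, inner_sub_right, inner_smul_left,
      inner_smul_right, RCLike.conj_to_real]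
    ring
  have h1 := hbound ((5 / 2 : ℝ) • v₀ - (3 / 2 : ℝ) • u)
  have h2 := hbound ((3 / 2 : ℝ) • v₀ - (5 / 2 : ℝ) • u)
  rw [norm_sub_sq_real] at h1 h2
  simp only [norm_smul, inner_smul_left, inner_smul_right, RCLike.conj_to_real, hv1, hu1] at h1 h2
  have hM0 : 0 ≤ M := abs_nonneg _
  have hMs : M ≤ 32 * s := by
    have h3 := hs u huN
    have h4 : |inner ℝ (T v₀) v₀ - inner ℝ (T u) u| ≤ 31 / 32 * M := by
      have h5 : |4 * (inner ℝ (T v₀) v₀ - inner ℝ (T u) u)| ≤ 31 / 8 * M := by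
        rw [key]
        refine (abs_sub _ _).trans ((add_le_add h1 h2).trans ?_)
        norm_num
        nlinarith
      rw [abs_mul] at h5
      norm_num at h5
      linarith
    have h6 : M ≤ |inner ℝ (T v₀) v₀ - inner ℝ (T u) u| + |inner ℝ (T u) u| := by
      have := abs_add_le (inner ℝ (T v₀) v₀ - inner ℝ (T u) u) (inner ℝ (T u) u)
      rwa [sub_add_cancel] at this
    linarith
  exact (hbound v).trans (by gcongr)

end Net

/-! ### The smallest singular value of a positive operator -/

/-- A positive operator is bounded below by its smallest singular value, because its singular values
are its eigenvalues. -/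
lemma singularValues_mul_norm_sq_le_inner {E : Type*} [NormedAddCommGroup E]
    [InnerProductSpace ℝ E] [FiniteDimensional ℝ E] {T : E →ₗ[ℝ] E} (hT : T.IsPositive) (v : E) :
    T.singularValues (Module.finrank ℝ E - 1) * ‖v‖ ^ 2 ≤ inner ℝ (T v) v := by
  have hsym := hT.isSymmetric
  set b := hsym.eigenvectorBasis rfl with hb
  have hTb : ∀ i, T (b i) = hsym.eigenvalues rfl i • b i := fun i => by
    exact hsym.apply_eigenvectorBasis rfl i
  have hle : ∀ i, T.singularValues (Module.finrank ℝ E - 1) ≤ hsym.eigenvalues rfl i := by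
    intro i
    have hadj : LinearMap.adjoint T = T := by
      rw [← LinearMap.isSelfAdjoint_iff', ← LinearMap.isSymmetric_iff_isSelfAdjoint]
      exact hsym
    have hev : Module.End.HasEigenvalue (LinearMap.adjoint T ∘ₗ T)
        (((hsym.eigenvalues rfl i) ^ 2 : ℝ)) := by
      refine Module.End.hasEigenvalue_of_hasEigenvector (x := b i) ⟨?_, ?_⟩
      · rw [Module.End.mem_eigenspace_iff, hadj, LinearMap.comp_apply, hTb, map_smul, hTb, smul_smul,
          sq]
      · simpa using b.toBasis.ne_zero i
    obtain ⟨j, hj⟩ := T.isSymmetric_adjoint_comp_self.exists_eigenvalues_eq rfl hev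
    have hj' : T.singularValues j ^ 2 = hsym.eigenvalues rfl i ^ 2 := by
      rw [T.sq_singularValues_fin rfl j]
      exact_mod_cast hj
    have h1 : T.singularValues j = hsym.eigenvalues rfl i :=
      (sq_eq_sq₀ (T.singularValues_nonneg j) (hT.nonneg_eigenvalues rfl i)).1 hj'
    rw [← h1]
    exact T.singularValues_antitone (by have := j.2; omega)
  have h1 : inner ℝ (T v) v = ∑ i, hsym.eigenvalues rfl i * (inner ℝ (b i) v) ^ 2 := by
    rw [← b.sum_inner_mul_inner]
    refine Finset.sum_congr rfl fun i _ => ?_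
    rw [hsym v (b i), hTb, inner_smul_right, real_inner_comm]
    ring
  have h2 : ‖v‖ ^ 2 = ∑ i, (inner ℝ (b i) v) ^ 2 := by
    rw [← real_inner_self_eq_norm_sq, ← b.sum_inner_mul_inner]
    refine Finset.sum_congr rfl fun i _ => ?_
    rw [real_inner_comm]
    ring
  rw [h1, h2, Finset.mul_sum]
  gcongr with i
  exact hle i

/-! ### The cost of a bagging into consecutive bags -/

section Bagging

variable {n : ℕ}

lemma sum_sub_bagMean_sq_le (y : Fin n → ℝ) (B : Finset (Fin n)) (c : ℝ) :
    ∑ i ∈ B, (y i - bagMean y B) ^ 2 ≤ ∑ i ∈ B, (y i - c) ^ 2 := by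
  rcases B.eq_empty_or_nonempty with rfl | hB
  · simp
  have hc : (0 : ℝ) < B.card := by exact_mod_cast hB.card_pos
  have hm : ∑ i ∈ B, y i = B.card * bagMean y B := by rw [bagMean]; field_simp
  have h : ∑ i ∈ B, (y i - c) ^ 2 =
      ∑ i ∈ B, (y i - bagMean y B) ^ 2 + B.card * (bagMean y B - c) ^ 2 := by
    have h1 : ∀ i, (y i - c) ^ 2 = (y i - bagMean y B) ^ 2 + 2 * (bagMean y B - c) * y i
        + (c ^ 2 - bagMean y B ^ 2) := by
      intro i; ring
    simp only [h1, Finset.sum_add_distrib, ← Finset.mul_sum, hm, Finset.sum_const, nsmul_eq_mul]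
    ring
  rw [h]
  have := mul_nonneg hc.le (sq_nonneg (bagMean y B - c))
  linarith

lemma sum_sub_bagMean_sq_le_range (y : Fin n → ℝ) (B : Finset (Fin n)) {a b : ℝ}
    (ha : ∀ i ∈ B, a ≤ y i) (hb : ∀ i ∈ B, y i ≤ b) :
    ∑ i ∈ B, (y i - bagMean y B) ^ 2 ≤ B.card * ((b - a) ^ 2 / 4) := by
  refine (sum_sub_bagMean_sq_le y B ((a + b) / 2)).trans ?_
  rw [← nsmul_eq_mul]
  refine Finset.sum_le_card_nsmul _ _ _ fun i hi => ?_
  nlinarith [ha i hi, hb i hi]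

/-- If the bags are consecutive for the order of the values, then their ranges do not overlap,
hence have total length at most `2 * M`, which bounds the within-bag squared deviations. -/
lemma baggingCost_le_of_ordered {y : Fin n → ℝ} {M K : ℝ} (hM : 0 ≤ M)
    (hy : ∀ i, |y i| ≤ M) {𝓑 : Bagging n} (hcard : ∀ B ∈ 𝓑.parts, (B.card : ℝ) ≤ K) (hK : 0 ≤ K)
    (hord : ∀ A ∈ 𝓑.parts, ∀ B ∈ 𝓑.parts, A ≠ B →
      (∀ i ∈ A, ∀ j ∈ B, y i ≤ y j) ∨ (∀ i ∈ A, ∀ j ∈ B, y j ≤ y i)) :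
    baggingCost y 𝓑 ≤ K * M ^ 2 := by
  have hrange : ∀ B ∈ 𝓑.parts, ∃ a b : ℝ, (∃ i ∈ B, y i = a) ∧ (∃ i ∈ B, y i = b) ∧
      (∀ i ∈ B, a ≤ y i) ∧ ∀ i ∈ B, y i ≤ b := by
    intro B hB
    have hne := 𝓑.nonempty_of_mem_parts hB
    obtain ⟨i, hi, hi'⟩ := B.exists_min_image y hne
    obtain ⟨j, hj, hj'⟩ := B.exists_max_image y hne
    exact ⟨y i, y j, ⟨i, hi, rfl⟩, ⟨j, hj, rfl⟩, hi', hj'⟩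
  choose! a b ha hb hay hyb using hrange
  have hab : ∀ B ∈ 𝓑.parts, a B ≤ b B := fun B hB => by
    obtain ⟨i, hi, h⟩ := ha B hB
    rw [← h]; exact hyb B hB i hi
  have hlen : ∑ B ∈ 𝓑.parts, (b B - a B) ≤ 2 * M := by
    have hdisj : (↑𝓑.parts : Set (Finset (Fin n))).PairwiseDisjoint
        fun B => Set.Ioo (a B) (b B) := by
      intro A hA B hB hAB
      rw [Function.onFun, Set.disjoint_left]
      rintro z ⟨h1, h2⟩ ⟨h3, h4⟩
      obtain ⟨i, hi, hi'⟩ := ha A hA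
      obtain ⟨j, hj, hj'⟩ := hb A hA
      obtain ⟨i', hi'm, hi''⟩ := ha B hB
      obtain ⟨j', hj'm, hj''⟩ := hb B hB
      rcases hord A hA B hB hAB with h | h
      · have := h j hj i' hi'm; linarith
      · have := h i hi j' hj'm; linarith
    have hvol : volume.real (⋃ B ∈ 𝓑.parts, Set.Ioo (a B) (b B)) = ∑ B ∈ 𝓑.parts, (b B - a B) := by
      rw [measureReal_biUnion_finset hdisj (fun _ _ => measurableSet_Ioo)
        (fun _ _ => measure_Ioo_lt_top.ne)]
      exact Finset.sum_congr rfl fun B hB => Real.volume_real_Ioo_of_le (hab B hB)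
    rw [← hvol]
    calc volume.real (⋃ B ∈ 𝓑.parts, Set.Ioo (a B) (b B)) ≤ volume.real (Set.Icc (-M) M) := by
          refine measureReal_mono ?_ measure_Icc_lt_top.ne
          refine Set.iUnion₂_subset fun B hB z hz => ?_
          obtain ⟨i, hi, hi'⟩ := ha B hB
          obtain ⟨j, hj, hj'⟩ := hb B hB
          have h1 := abs_le.1 (hy i)
          have h2 := abs_le.1 (hy j)
          exact ⟨by linarith [hz.1], by linarith [hz.2]⟩
      _ = 2 * M := by rw [Real.volume_real_Icc_of_le (by linarith)]; ring
  have hsingle : ∀ B ∈ 𝓑.parts, b B - a B ≤ 2 * M := fun B hB =>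
    (Finset.single_le_sum (f := fun B => b B - a B) (fun B hB => sub_nonneg.2 (hab B hB)) hB).trans
      hlen
  calc baggingCost y 𝓑 ≤ ∑ B ∈ 𝓑.parts, K * M / 2 * (b B - a B) := by
        refine Finset.sum_le_sum fun B hB => ?_
        refine (sum_sub_bagMean_sq_le_range y B (hay B hB) (hyb B hB)).trans ?_
        have h0 := sub_nonneg.2 (hab B hB)
        calc (B.card : ℝ) * ((b B - a B) ^ 2 / 4) ≤ K * (2 * M * (b B - a B) / 4) := by
              gcongr
              · exact hcard B hB
              · rw [sq]; gcongr; exact hsingle B hB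
          _ = _ := by ring
    _ = K * M / 2 * ∑ B ∈ 𝓑.parts, (b B - a B) := by rw [Finset.mul_sum]
    _ ≤ K * M / 2 * (2 * M) := by gcongr
    _ = K * M ^ 2 := by ring

/-- Sorting the samples and cutting them into `n / k` consecutive bags, the last of which takes the
remainder, gives bags with at least `k` and at most `2 * k` members. -/
lemma exists_ordered_bagging {k : ℕ} (hk : 0 < k) (hkn : k ≤ n) (y : Fin n → ℝ) :
    ∃ 𝓑 : Bagging n, HasMinBagSize k 𝓑 ∧ (∀ B ∈ 𝓑.parts, B.card ≤ 2 * k) ∧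
      ∀ A ∈ 𝓑.parts, ∀ B ∈ 𝓑.parts, A ≠ B →
        (∀ i ∈ A, ∀ j ∈ B, y i ≤ y j) ∨ (∀ i ∈ A, ∀ j ∈ B, y j ≤ y i) := by
  classical
  -- `g i` is the number of the bag of sample `i`
  set τ := Tuple.sort y with hτ
  have hmono : ∀ i j, τ.symm i ≤ τ.symm j → y i ≤ y j := fun i j h => by
    simpa [τ] using Tuple.monotone_sort y h
  set q := n / k with hq
  have hq1 : 1 ≤ q := (Nat.one_le_div_iff hk).2 hkn
  have hqn : q * k ≤ n := Nat.div_mul_le_self n k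
  have hnq : n < (q + 1) * k := by
    rw [mul_comm]; exact Nat.lt_mul_div_succ n hk
  let g : Fin n → ℕ := fun i => min ((τ.symm i : ℕ) / k) (q - 1)
  have hg : ∀ i j, g i < g j → y i ≤ y j := by
    intro i j h
    refine hmono i j (le_of_not_gt fun hlt => ?_)
    have : (τ.symm j : ℕ) / k ≤ (τ.symm i : ℕ) / k := Nat.div_le_div_right (le_of_lt hlt)
    simp only [g] at h
    omega
  have hparts : ∀ B ∈ (Finpartition.ofSetoid (Setoid.ker g)).parts, ∃ i, ∀ j, j ∈ B ↔ g j = g i := by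
    intro B hB
    obtain ⟨i, hi⟩ := Finpartition.nonempty_of_mem_parts _ hB
    refine ⟨i, fun j => ?_⟩
    rw [← Finpartition.part_eq_of_mem _ hB hi, Finpartition.mem_part_ofSetoid_iff_rel,
      Setoid.ker_def, eq_comm]
  refine ⟨Finpartition.ofSetoid (Setoid.ker g), fun B hB => ?_, fun B hB => ?_,
    fun A hA B hB hAB => ?_⟩
  · obtain ⟨i, hi⟩ := hparts B hB
    have ha : g i + 1 ≤ q := by simp only [g]; omega
    have hlt : ∀ r : Fin k, g i * k + r < n := fun r => by
      have := Nat.mul_le_mul_right k ha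
      have := r.2
      rw [add_mul] at *
      omega
    let f : Fin k → Fin n := fun r => τ ⟨g i * k + r, hlt r⟩
    have hf : Function.Injective f := fun r s h => by
      have := τ.injective h
      simp only [Fin.mk.injEq] at this
      ext; omega
    calc k = (Finset.univ.image f).card := by
          rw [Finset.card_image_of_injective _ hf, Finset.card_univ, Fintype.card_fin]
      _ ≤ B.card := by
          refine Finset.card_le_card fun j hj => ?_
          obtain ⟨r, -, rfl⟩ := Finset.mem_image.1 hj
          rw [hi]
          have : (g i * k + (r : ℕ)) / k = g i := by
            rw [mul_comm, Nat.mul_add_div hk, Nat.div_eq_of_lt r.2, add_zero]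
          show min ((τ.symm (τ ⟨g i * k + r, hlt r⟩) : ℕ) / k) (q - 1) = g i
          rw [Equiv.symm_apply_apply, this]
          omega
  · obtain ⟨i, hi⟩ := hparts B hB
    have hb : ∀ j ∈ B, g i * k ≤ τ.symm j ∧ (τ.symm j : ℕ) < g i * k + 2 * k := by
      intro j hj
      have hj' : min ((τ.symm j : ℕ) / k) (q - 1) = g i := (hi j).1 hj
      have h1 : (τ.symm j : ℕ) / k * k ≤ τ.symm j := Nat.div_mul_le_self _ _
      have h2 : (τ.symm j : ℕ) < ((τ.symm j : ℕ) / k + 1) * k := by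
        rw [mul_comm]; exact Nat.lt_mul_div_succ _ hk
      have h3 := (τ.symm j).2
      constructor
      · exact (Nat.mul_le_mul_right k (by omega)).trans h1
      · rcases le_total ((τ.symm j : ℕ) / k) (q - 1) with h | h
        · rw [min_eq_left h] at hj'
          rw [hj', add_mul] at h2
          omega
        · rw [min_eq_right h] at hj'
          have : q + 1 = g i + 2 := by omega
          rw [this, add_mul] at hnq
          omega
    calc B.card ≤ (Finset.range (2 * k)).card := by
          refine Finset.card_le_card_of_injOn (fun j => (τ.symm j : ℕ) - g i * k) ?_ ?_
          · intro j hj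
            have := hb j hj
            simp only [Finset.coe_range, Set.mem_Iio]
            omega
          · intro j hj j' hj' h
            have := hb j hj
            have := hb j' hj'
            simp only at h
            exact τ.symm.injective (Fin.ext (by omega))
      _ = 2 * k := Finset.card_range _
  · obtain ⟨a, ha⟩ := hparts A hA
    obtain ⟨b, hb⟩ := hparts B hB
    rcases lt_trichotomy (g a) (g b) with h | h | h
    · exact .inl fun i hi j hj => hg i j (by rw [(ha i).1 hi, (hb j).1 hj]; exact h)
    · exact absurd (Finset.ext fun i => by rw [ha, hb, h]) hAB
    · exact .inr fun i hi j hj => hg j i (by rw [(ha i).1 hi, (hb j).1 hj]; exact h)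

/-- An optimal bagging costs at most as much as the sorted one with bag sizes between `k` and
`2 * k`. -/
lemma baggingCost_le_of_curated {k : ℕ} (hk : 0 < k) {y : Fin n → ℝ} {M : ℝ} (hM : 0 ≤ M)
    (hy : ∀ i, |y i| ≤ M) {𝓑 : Bagging n} (h𝓑 : IsOptimalBagging k y 𝓑 ∨ IsSortedBagging k y 𝓑) :
    baggingCost y 𝓑 ≤ 2 * k * M ^ 2 := by
  rcases Nat.eq_zero_or_pos n with rfl | hn
  · have : baggingCost y 𝓑 = 0 :=
      Finset.sum_eq_zero fun B _ => by simp [Finset.eq_empty_of_isEmpty B]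
    rw [this]; positivity
  rcases h𝓑 with ⟨hmin, hopt⟩ | ⟨hcard, hord⟩
  · have hkn : k ≤ n := by
      have hB := 𝓑.part_mem.2 (Finset.mem_univ (⟨0, hn⟩ : Fin n))
      simpa using (hmin _ hB).trans (Finset.card_le_univ _)
    obtain ⟨𝓑', h1, h2, h3⟩ := exists_ordered_bagging hk hkn y
    exact (hopt 𝓑' h1).trans (baggingCost_le_of_ordered hM hy
      (fun B hB => by exact_mod_cast h2 B hB) (by positivity) h3)
  · exact baggingCost_le_of_ordered hM hy
      (fun B hB => by rw [hcard B hB]; linarith [(Nat.cast_nonneg k : (0 : ℝ) ≤ k)])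
      (by positivity) hord

/-! ### The bagging matrix -/

lemma sum_parts_sum (𝓑 : Bagging n) (f : Finset (Fin n) → Fin n → ℝ) :
    ∑ B ∈ 𝓑.parts, ∑ i ∈ B, f B i = ∑ i, f (𝓑.part i) i := by
  have h : ∀ B ∈ 𝓑.parts, ∑ i ∈ B, f B i = ∑ i ∈ B, f (𝓑.part i) i := fun B hB =>
    Finset.sum_congr rfl fun i hi => by rw [𝓑.part_eq_of_mem hB hi]
  rw [Finset.sum_congr rfl h]
  have h2 : ∑ i ∈ 𝓑.parts.biUnion id, f (𝓑.part i) i = ∑ i, f (𝓑.part i) i := by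
    rw [𝓑.biUnion_parts]
  rw [← h2, Finset.sum_biUnion 𝓑.supIndep.pairwiseDisjoint]
  rfl

/-- `SᵀS` replaces every value by the average over its bag. -/
lemma bagMatrix_transpose_mul_self_mulVec (𝓑 : Bagging n) (y : Fin n → ℝ) (i : Fin n) :
    (((bagMatrix 𝓑).transpose * bagMatrix 𝓑).mulVec y) i = bagMean y (𝓑.part i) := by
  have hi := 𝓑.part_mem.2 (Finset.mem_univ i)
  have him : i ∈ 𝓑.part i := 𝓑.mem_part (Finset.mem_univ i)
  rw [← Matrix.mulVec_mulVec]
  simp only [Matrix.mulVec, dotProduct, Matrix.transpose_apply, bagMatrix, Matrix.of_apply]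
  rw [Finset.sum_eq_single (⟨𝓑.part i, hi⟩ : 𝓑.parts)]
  · simp only [him, if_true, ite_mul, zero_mul, Finset.sum_ite_mem, Finset.univ_inter,
      ← Finset.mul_sum, bagMean]
    rw [← mul_assoc, div_mul_div_comm, Real.mul_self_sqrt (by positivity)]
    ring
  · intro B _ hB
    rw [if_neg, zero_mul]
    intro h
    exact hB (Subtype.ext (𝓑.part_eq_of_mem B.2 h).symm)
  · simp

lemma baggingCost_eq_sum (y : Fin n → ℝ) (𝓑 : Bagging n) :
    baggingCost y 𝓑 =
      ∑ i, (((bagMatrix 𝓑).transpose * bagMatrix 𝓑 - 1).mulVec y i) ^ 2 := by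
  rw [baggingCost, sum_parts_sum 𝓑 fun B i => (y i - bagMean y B) ^ 2]
  refine Finset.sum_congr rfl fun i _ => ?_
  rw [Matrix.sub_mulVec, Pi.sub_apply, bagMatrix_transpose_mul_self_mulVec, Matrix.one_mulVec]
  ring

lemma bagMatrix_mul_transpose (𝓑 : Bagging n) :
    bagMatrix 𝓑 * (bagMatrix 𝓑).transpose = 1 := by
  ext A B
  simp only [Matrix.mul_apply, Matrix.transpose_apply, bagMatrix, Matrix.of_apply,
    Matrix.one_apply]
  have hA : (0 : ℝ) < (A : Finset (Fin n)).card := by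
    exact_mod_cast (𝓑.nonempty_of_mem_parts A.2).card_pos
  by_cases h : A = B
  · subst h
    simp only [if_true, ite_mul, zero_mul, mul_ite, mul_zero, Finset.sum_ite_mem,
      Finset.univ_inter, Finset.sum_const, nsmul_eq_mul]
    rw [Finset.inter_self, div_mul_div_comm, Real.mul_self_sqrt hA.le]
    field_simp
  · rw [if_neg h]
    refine Finset.sum_eq_zero fun i _ => ?_
    by_cases hiA : i ∈ (A : Finset (Fin n))
    · rw [if_neg (c := i ∈ (B : Finset (Fin n))), mul_zero]
      intro hiB
      exact h (Subtype.ext (𝓑.eq_of_mem_parts A.2 B.2 hiA hiB))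
    · rw [if_neg hiA, zero_mul]

end Bagging

/-! ### Least squares for a design bounded below -/

section LeastSquares

open Matrix

variable {ι κ : Type*} [Fintype ι] [Fintype κ]

lemma norm_toLp_sq (v : ι → ℝ) : ‖WithLp.toLp 2 v‖ ^ 2 = v ⬝ᵥ v := by
  rw [EuclideanSpace.real_norm_sq_eq]
  simp [dotProduct, sq]

lemma mulVec_dotProduct (A : Matrix ι κ ℝ) (v : κ → ℝ) (w : ι → ℝ) :
    (A *ᵥ v) ⬝ᵥ w = v ⬝ᵥ (Aᵀ *ᵥ w) := by
  rw [dotProduct_mulVec, vecMul_transpose]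

/-- A bound on the operator norm of a matrix is one for its transpose. -/
lemma mul_transpose_mulVec_sq_le {V : Matrix ι κ ℝ} {l : ℝ} (hl : 0 < l)
    (hV : ∀ z, l * ((V *ᵥ z) ⬝ᵥ (V *ᵥ z)) ≤ z ⬝ᵥ z) (u : ι → ℝ) :
    l * ((Vᵀ *ᵥ u) ⬝ᵥ (Vᵀ *ᵥ u)) ≤ u ⬝ᵥ u := by
  have h1 := hV (Vᵀ *ᵥ u)
  set w := V *ᵥ (Vᵀ *ᵥ u) with hw
  have h2 : (Vᵀ *ᵥ u) ⬝ᵥ (Vᵀ *ᵥ u) = w ⬝ᵥ u := by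
    rw [mulVec_dotProduct, transpose_transpose, dotProduct_comm]
  have h3 : 0 ≤ (u - l • w) ⬝ᵥ (u - l • w) := by
    simpa using dotProduct_star_self_nonneg (u - l • w)
  have h4 : (u - l • w) ⬝ᵥ (u - l • w) = u ⬝ᵥ u - 2 * l * (w ⬝ᵥ u) + l * (l * (w ⬝ᵥ w)) := by
    simp only [sub_dotProduct, dotProduct_sub, smul_dotProduct, dotProduct_smul, smul_eq_mul,
      dotProduct_comm u w]
    ring
  rw [h2] at h1 ⊢
  nlinarith

lemma mul_sum_sq_le_card {V : Matrix ι κ ℝ} {l : ℝ}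
    (hV : ∀ z, l * ((V *ᵥ z) ⬝ᵥ (V *ᵥ z)) ≤ z ⬝ᵥ z) :
    l * ∑ b, ∑ a, V a b ^ 2 ≤ Fintype.card κ := by
  classical
  rw [Finset.mul_sum]
  calc ∑ b, l * ∑ a, V a b ^ 2 ≤ ∑ _b : κ, (1 : ℝ) := by
        refine Finset.sum_le_sum fun b _ => ?_
        simpa [dotProduct, sq, Pi.single_apply] using hV (Pi.single b 1)
    _ = _ := by simp

/-- The squared Frobenius norm is at most the squared operator norm times either dimension. -/
lemma mul_sum_sq_le_min_card {V : Matrix ι κ ℝ} {l : ℝ} (hl : 0 < l)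
    (hV : ∀ z, l * ((V *ᵥ z) ⬝ᵥ (V *ᵥ z)) ≤ z ⬝ᵥ z) :
    l * ∑ a, ∑ b, V a b ^ 2 ≤ (min (Fintype.card κ) (Fintype.card ι) : ℕ) := by
  rw [Nat.cast_min]
  refine le_min ?_ ?_
  · rw [Finset.sum_comm]; exact mul_sum_sq_le_card hV
  · exact mul_sum_sq_le_card (V := Vᵀ) (mul_transpose_mulVec_sq_le hl hV)

variable [DecidableEq κ] {X : Matrix ι κ ℝ} {l : ℝ}

lemma isUnit_det_of_le (hl : 0 < l) (hX : ∀ v, l * (v ⬝ᵥ v) ≤ (X *ᵥ v) ⬝ᵥ (X *ᵥ v)) :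
    IsUnit (Xᵀ * X).det := by
  rw [isUnit_iff_ne_zero]
  intro h
  obtain ⟨v, hv, hv'⟩ := Matrix.exists_mulVec_eq_zero_iff.2 h
  have h1 := hX v
  rw [mulVec_dotProduct, mulVec_mulVec, hv', dotProduct_zero] at h1
  have h2 : 0 < v ⬝ᵥ v := by
    have := (dotProduct_star_self_pos_iff (v := v)).2 hv
    simpa using this
  nlinarith

/-- The pseudo-inverse of a design bounded below by `√l` has norm at most `1 / √l`. -/
lemma mul_pinv_mulVec_sq_le (hl : 0 < l)
    (hX : ∀ v, l * (v ⬝ᵥ v) ≤ (X *ᵥ v) ⬝ᵥ (X *ᵥ v)) (z : ι → ℝ) :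
    l * ((((Xᵀ * X)⁻¹ * Xᵀ) *ᵥ z) ⬝ᵥ (((Xᵀ * X)⁻¹ * Xᵀ) *ᵥ z)) ≤ z ⬝ᵥ z := by
  set w := ((Xᵀ * X)⁻¹ * Xᵀ) *ᵥ z with hw
  have hdet := isUnit_det_of_le hl hX
  have h1 : Xᵀ *ᵥ (X *ᵥ w) = Xᵀ *ᵥ z := by
    rw [hw, mulVec_mulVec, mulVec_mulVec, ← Matrix.mul_assoc,
      Matrix.mul_nonsing_inv _ hdet, Matrix.one_mul]
  have h2 : (X *ᵥ w) ⬝ᵥ (X *ᵥ w) = (X *ᵥ w) ⬝ᵥ z := by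
    rw [mulVec_dotProduct, h1, ← mulVec_dotProduct]
  have h3 : 0 ≤ (z - X *ᵥ w) ⬝ᵥ (z - X *ᵥ w) := by
    simpa using dotProduct_star_self_nonneg (z - X *ᵥ w)
  have h4 : (z - X *ᵥ w) ⬝ᵥ (z - X *ᵥ w) = z ⬝ᵥ z - (X *ᵥ w) ⬝ᵥ (X *ᵥ w) := by
    rw [sub_dotProduct, dotProduct_sub, dotProduct_sub, dotProduct_comm z (X *ᵥ w), h2]
    ring
  linarith [hX w]

/-- A minimizer of the residual sum of squares is the least-squares solution. -/
lemma eq_pinv_mulVec_of_forall_le (hl : 0 < l)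
    (hX : ∀ v, l * (v ⬝ᵥ v) ≤ (X *ᵥ v) ⬝ᵥ (X *ᵥ v)) {z : ι → ℝ} {w : κ → ℝ}
    (hw : ∀ v, (z - X *ᵥ w) ⬝ᵥ (z - X *ᵥ w) ≤ (z - X *ᵥ v) ⬝ᵥ (z - X *ᵥ v)) :
    w = ((Xᵀ * X)⁻¹ * Xᵀ) *ᵥ z := by
  set w₀ := ((Xᵀ * X)⁻¹ * Xᵀ) *ᵥ z with hw₀
  have hdet := isUnit_det_of_le hl hX
  have h1 : Xᵀ *ᵥ (z - X *ᵥ w₀) = 0 := by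
    rw [mulVec_sub, hw₀, mulVec_mulVec, mulVec_mulVec, ← Matrix.mul_assoc,
      Matrix.mul_nonsing_inv _ hdet, Matrix.one_mul, sub_self]
  have h2 : z - X *ᵥ w = (z - X *ᵥ w₀) - X *ᵥ (w - w₀) := by
    rw [mulVec_sub]; abel
  have h3 := hw w₀
  have h4 : (X *ᵥ (w - w₀)) ⬝ᵥ (z - X *ᵥ w₀) = 0 := by
    rw [mulVec_dotProduct, h1, dotProduct_zero]
  rw [h2, sub_dotProduct, dotProduct_sub _ (z - X *ᵥ w₀), dotProduct_sub _ (z - X *ᵥ w₀), h4,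
    dotProduct_comm _ (X *ᵥ (w - w₀)), h4] at h3
  have h5 := hX (w - w₀)
  have h6 : (w - w₀) ⬝ᵥ (w - w₀) ≤ 0 := by nlinarith
  have h7 : 0 ≤ (w - w₀) ⬝ᵥ (w - w₀) := by
    simpa using dotProduct_star_self_nonneg (w - w₀)
  exact sub_eq_zero.1 (dotProduct_self_eq_zero.1 (le_antisymm h6 h7))

end LeastSquares

/-! ### The estimator on aggregated responses -/

section Estimator

open Matrix

variable {n d : ℕ}

/-- The deterministic part `(XᵀX)⁻¹ Xᵀ (SᵀS - I) X θ` of the estimation error. -/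
noncomputable def biasVec (𝓑 : Bagging n) (x : Fin n → EuclideanSpace ℝ (Fin d))
    (θ : EuclideanSpace ℝ (Fin d)) : Fin d → ℝ :=
  (((designMatrix x)ᵀ * designMatrix x)⁻¹ * (designMatrix x)ᵀ *
    ((bagMatrix 𝓑)ᵀ * bagMatrix 𝓑 - 1) * designMatrix x) *ᵥ (θ : Fin d → ℝ)

/-- The matrix `(XᵀX)⁻¹ Xᵀ SᵀS` through which the noise enters the estimation error. -/
noncomputable def noiseMatrix (𝓑 : Bagging n) (x : Fin n → EuclideanSpace ℝ (Fin d)) :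
    Matrix (Fin d) (Fin n) ℝ :=
  ((designMatrix x)ᵀ * designMatrix x)⁻¹ * (designMatrix x)ᵀ * ((bagMatrix 𝓑)ᵀ * bagMatrix 𝓑)

lemma biasTerm_eq_dotProduct (𝓑 : Bagging n) (x : Fin n → EuclideanSpace ℝ (Fin d))
    (θ : EuclideanSpace ℝ (Fin d)) : biasTerm 𝓑 x θ = biasVec 𝓑 x θ ⬝ᵥ biasVec 𝓑 x θ :=
  norm_toLp_sq _

lemma designMatrix_mulVec (x : Fin n → EuclideanSpace ℝ (Fin d)) (θ : EuclideanSpace ℝ (Fin d))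
    (i : Fin n) : (designMatrix x *ᵥ (θ : Fin d → ℝ)) i = inner ℝ (x i) θ := by
  simp [designMatrix, mulVec, dotProduct, PiLp.inner_apply, mul_comm]

lemma eventLoss_eq (𝓑 : Bagging n) (x : Fin n → EuclideanSpace ℝ (Fin d)) (y : Fin n → ℝ)
    (θ : EuclideanSpace ℝ (Fin d)) :
    eventLoss 𝓑 x y θ = 1 / (n : ℝ) *
      ((((bagMatrix 𝓑)ᵀ * bagMatrix 𝓑) *ᵥ y - designMatrix x *ᵥ (θ : Fin d → ℝ)) ⬝ᵥ
        (((bagMatrix 𝓑)ᵀ * bagMatrix 𝓑) *ᵥ y - designMatrix x *ᵥ (θ : Fin d → ℝ))) := by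
  rw [eventLoss, sum_parts_sum 𝓑 fun B i => (bagMean y B - inner ℝ (x i) θ) ^ 2]
  congr 1
  refine Finset.sum_congr rfl fun i _ => ?_
  rw [Pi.sub_apply, bagMatrix_transpose_mul_self_mulVec, designMatrix_mulVec, sq]

variable {x : Fin n → EuclideanSpace ℝ (Fin d)} {l : ℝ}

lemma biasTerm_le_baggingCost_div (hl : 0 < l)
    (hX : ∀ v, l * (v ⬝ᵥ v) ≤ (designMatrix x *ᵥ v) ⬝ᵥ (designMatrix x *ᵥ v))
    (𝓑 : Bagging n) (θ : EuclideanSpace ℝ (Fin d)) :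
    biasTerm 𝓑 x θ ≤ baggingCost (fun i => inner ℝ (x i) θ) 𝓑 / l := by
  rw [le_div_iff₀ hl, mul_comm, biasTerm_eq_dotProduct, biasVec, ← mulVec_mulVec, ← mulVec_mulVec]
  refine (mul_pinv_mulVec_sq_le hl hX _).trans_eq ?_
  rw [baggingCost_eq_sum, dotProduct]
  have : designMatrix x *ᵥ (θ : Fin d → ℝ) = fun i => inner ℝ (x i) θ :=
    funext fun i => designMatrix_mulVec x θ i
  simp only [this, sq]

lemma sub_eq_biasVec_add_noise (hn : 0 < n) (hl : 0 < l)
    (hX : ∀ v, l * (v ⬝ᵥ v) ≤ (designMatrix x *ᵥ v) ⬝ᵥ (designMatrix x *ᵥ v))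
    {𝓑 : Bagging n} {θ θ' : EuclideanSpace ℝ (Fin d)} {e : Fin n → ℝ}
    (hθ : ∀ w, eventLoss 𝓑 x (fun i => inner ℝ (x i) θ + e i) θ' ≤
      eventLoss 𝓑 x (fun i => inner ℝ (x i) θ + e i) w) :
    θ' - θ = WithLp.toLp 2 (biasVec 𝓑 x θ + noiseMatrix 𝓑 x *ᵥ e) := by
  have hn' : (0 : ℝ) < 1 / n := by positivity
  have hy : (fun i => inner ℝ (x i) θ + e i) = designMatrix x *ᵥ (θ : Fin d → ℝ) + e := by
    ext i; rw [Pi.add_apply, designMatrix_mulVec]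
  have h1 : (θ' : Fin d → ℝ) = _ := eq_pinv_mulVec_of_forall_le hl hX
    (z := ((bagMatrix 𝓑)ᵀ * bagMatrix 𝓑) *ᵥ (designMatrix x *ᵥ (θ : Fin d → ℝ) + e))
    (w := (θ' : Fin d → ℝ)) fun v => by
      have := hθ (WithLp.toLp 2 v)
      rw [eventLoss_eq, eventLoss_eq, hy] at this
      exact le_of_mul_le_mul_left this hn'
  have hdet := isUnit_det_of_le hl hX
  have h2 : (((designMatrix x)ᵀ * designMatrix x)⁻¹ * (designMatrix x)ᵀ) *ᵥ
      (designMatrix x *ᵥ (θ : Fin d → ℝ)) = θ := by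
    rw [mulVec_mulVec, Matrix.mul_assoc, Matrix.nonsing_inv_mul _ hdet, one_mulVec]
  ext a
  show (θ' : Fin d → ℝ) a - (θ : Fin d → ℝ) a = _
  rw [h1]
  nth_rewrite 2 [← h2]
  simp only [biasVec, noiseMatrix, ← mulVec_mulVec, mulVec_add, sub_mulVec, one_mulVec, mulVec_sub,
    Pi.add_apply, Pi.sub_apply]
  ring

/-- The total variance of the noise part is at most `min m d / l`: since `S Sᵀ = I`, its Frobenius
norm is that of `(XᵀX)⁻¹ Xᵀ Sᵀ`, a `d × m` matrix of norm at most `1 / √l`. -/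
lemma sum_noiseMatrix_sq_le (hl : 0 < l)
    (hX : ∀ v, l * (v ⬝ᵥ v) ≤ (designMatrix x *ᵥ v) ⬝ᵥ (designMatrix x *ᵥ v))
    (𝓑 : Bagging n) :
    ∑ a, ∑ i, noiseMatrix 𝓑 x a i ^ 2 ≤ (min 𝓑.parts.card d : ℕ) / l := by
  set A := ((designMatrix x)ᵀ * designMatrix x)⁻¹ * (designMatrix x)ᵀ with hA
  set S := bagMatrix 𝓑 with hS
  have hSS : S * Sᵀ = 1 := bagMatrix_mul_transpose 𝓑
  have hfrob : ∀ {p q : Type} [Fintype p] [Fintype q] (M : Matrix p q ℝ),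
      ∑ a, ∑ b, M a b ^ 2 = (M * Mᵀ).trace := by
    intro p q _ _ M
    simp [Matrix.trace, Matrix.mul_apply, sq]
  have h1 : ∑ a, ∑ i, noiseMatrix 𝓑 x a i ^ 2 = ∑ a, ∑ b, (A * Sᵀ) a b ^ 2 := by
    rw [hfrob, hfrob]
    have : noiseMatrix 𝓑 x = A * Sᵀ * S := by rw [noiseMatrix, Matrix.mul_assoc A]
    rw [this, transpose_mul (A * Sᵀ) S, Matrix.mul_assoc, ← Matrix.mul_assoc S, hSS, Matrix.one_mul]
  have h2 := mul_sum_sq_le_min_card (V := A * Sᵀ) hl fun z => by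
    rw [← mulVec_mulVec]
    refine (mul_pinv_mulVec_sq_le hl hX _).trans_eq ?_
    rw [mulVec_dotProduct, transpose_transpose, mulVec_mulVec, hSS, one_mulVec]
  rw [h1, le_div_iff₀ hl, mul_comm]
  simpa using h2

end Estimator

/-! ### Conditional expectation by freezing an independent variable -/

/-- If `Z` is `F (X, Y)` with `Y` independent of `X` while `X ∈ G`, then on that event the
conditional expectation of `Z` given `X` is bounded by any bound on the expectations
of `F (x, Y)`, `x ∈ G`. -/
lemma ae_condLExp_comap_le_of_indepFun {Ω 𝒳 𝒴 : Type*} {mΩ : MeasurableSpace Ω}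
    [m𝒳 : MeasurableSpace 𝒳] [MeasurableSpace 𝒴] {P : Measure Ω} [IsProbabilityMeasure P]
    {X : Ω → 𝒳} {Y : Ω → 𝒴} (hX : Measurable X) (hY : Measurable Y) (hXY : IndepFun X Y P)
    {Z : Ω → ENNReal} {F : 𝒳 × 𝒴 → ENNReal} (hF : Measurable F) {g : 𝒳 → ENNReal}
    (hg : Measurable g) {G : Set 𝒳} (hG : MeasurableSet G)
    (hZ : ∀ᵐ ω ∂P, X ω ∈ G → Z ω = F (X ω, Y ω))
    (hFg : ∀ x ∈ G, ∫⁻ ω, F (x, Y ω) ∂P ≤ g x) :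
    ∀ᵐ ω ∂P, X ω ∈ G → condLExp (MeasurableSpace.comap X m𝒳) P Z ω ≤ g (X ω) := by
  have hm : MeasurableSpace.comap X m𝒳 ≤ mΩ := hX.comap_le
  have hXm : Measurable[m𝒳.comap X] X := comap_measurable X
  have hGm : MeasurableSet[m𝒳.comap X] (X ⁻¹' G) := hXm hG
  have hcm : Measurable[m𝒳.comap X] (condLExp (m𝒳.comap X) P Z) := measurable_condLExp _ _ _
  have key : (X ⁻¹' G).indicator (condLExp (m𝒳.comap X) P Z) ≤ᵐ[P.trim hm] fun ω => g (X ω) := by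
    refine ae_le_of_forall_setLIntegral_le_of_sigmaFinite (hcm.indicator hGm) fun s hs _ => ?_
    obtain ⟨T, hT, rfl⟩ := hs
    have hTm : MeasurableSet[m𝒳.comap X] (X ⁻¹' T) := hXm hT
    have hTG : MeasurableSet (G ∩ T) := hG.inter hT
    rw [@setLIntegral_indicator _ (m𝒳.comap X) _ _ _ hGm, ← Set.preimage_inter,
      setLIntegral_condLExp_trim hm P Z (hXm hTG)]
    have hlaw : P.map (fun ω => (X ω, Y ω)) = (P.map X).prod (P.map Y) :=
      (indepFun_iff_map_prod_eq_prod_map_map hX.aemeasurable hY.aemeasurable).1 hXY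
    have hmX := Measure.isProbabilityMeasure_map (μ := P) hX.aemeasurable
    have hmY := Measure.isProbabilityMeasure_map (μ := P) hY.aemeasurable
    calc ∫⁻ ω in X ⁻¹' (G ∩ T), Z ω ∂P = ∫⁻ ω in X ⁻¹' (G ∩ T), F (X ω, Y ω) ∂P := by
          refine setLIntegral_congr_fun_ae (hX hTG) ?_
          filter_upwards [hZ] with ω hω h using hω h.1
      _ = ∫⁻ z in (G ∩ T) ×ˢ Set.univ, F z ∂(P.map fun ω => (X ω, Y ω)) := by
          rw [setLIntegral_map (hTG.prod MeasurableSet.univ) hF (hX.prodMk hY)]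
          congr 2
          ext ω; simp
      _ = ∫⁻ x in G ∩ T, ∫⁻ y, F (x, y) ∂(P.map Y) ∂(P.map X) := by
          rw [hlaw, setLIntegral_prod _ hF.aemeasurable]
          simp
      _ ≤ ∫⁻ x in G ∩ T, g x ∂(P.map X) := by
          refine setLIntegral_mono hg fun x hx => ?_
          rw [lintegral_map (f := fun y => F (x, y)) (hF.comp measurable_prodMk_left) hY]
          exact hFg x hx.1
      _ ≤ ∫⁻ x in T, g x ∂(P.map X) := lintegral_mono_set Set.inter_subset_right
      _ = ∫⁻ ω in X ⁻¹' T, g (X ω) ∂P := setLIntegral_map hT hg hX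
      _ = ∫⁻ ω in X ⁻¹' T, g (X ω) ∂(P.trim hm) :=
          (setLIntegral_trim hm (hg.comp hXm) hTm).symm
  filter_upwards [ae_of_ae_trim hm key] with ω hω h
  rwa [Set.indicator_of_mem (show ω ∈ X ⁻¹' G from h)] at hω

/-! ### The second moment of an affine function of the noise -/

section Noise

open Matrix

variable {Ω : Type*} {mΩ : MeasurableSpace Ω} {P : Measure Ω}

lemma integrable_mul_of_memLp_two {n : ℕ} {ε : Fin n → Ω → ℝ} (hε : ∀ i, MemLp (ε i) 2 P)
    (i j : Fin n) : Integrable (fun ω => ε i ω * ε j ω) P :=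
  (hε i).integrable_mul (hε j)

variable [IsProbabilityMeasure P]

lemma lintegral_norm_sq_add_mulVec {n d : ℕ} {σ : ℝ} {ε : Fin n → Ω → ℝ}
    (hε2 : ∀ i, MemLp (ε i) 2 P) (hε0 : ∀ i, ∫ ω, ε i ω ∂P = 0)
    (hεcov : ∀ i j, ∫ ω, ε i ω * ε j ω ∂P = if i = j then σ ^ 2 else 0)
    (b : Fin d → ℝ) (W : Matrix (Fin d) (Fin n) ℝ) :
    ∫⁻ ω, ENNReal.ofReal (‖WithLp.toLp 2 (b + W *ᵥ fun i => ε i ω)‖ ^ 2) ∂P =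
      ENNReal.ofReal (b ⬝ᵥ b + σ ^ 2 * ∑ a, ∑ i, W a i ^ 2) := by
  have hε1 : ∀ i, Integrable (ε i) P := fun i => (hε2 i).integrable one_le_two
  have hexp : ∀ ω, ‖WithLp.toLp 2 (b + W *ᵥ fun i => ε i ω)‖ ^ 2 =
      ∑ a, (b a * b a + ∑ i, 2 * b a * W a i * ε i ω +
        ∑ i, ∑ j, W a i * W a j * (ε i ω * ε j ω)) := by
    intro ω
    rw [norm_toLp_sq, dotProduct]
    refine Finset.sum_congr rfl fun a _ => ?_
    have h1 : ∑ i, ∑ j, W a i * W a j * (ε i ω * ε j ω) = (∑ i, W a i * ε i ω) ^ 2 := by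
      rw [sq, Finset.sum_mul_sum]
      refine Finset.sum_congr rfl fun i _ => Finset.sum_congr rfl fun j _ => by ring
    have h2 : ∑ i, 2 * b a * W a i * ε i ω = 2 * b a * ∑ i, W a i * ε i ω := by
      rw [Finset.mul_sum]
      exact Finset.sum_congr rfl fun i _ => by ring
    rw [h1, h2, Pi.add_apply, mulVec, dotProduct]
    ring
  have hint1 : ∀ a, Integrable (fun ω => ∑ i, 2 * b a * W a i * ε i ω) P := fun a =>
    integrable_finsetSum _ fun i _ => (hε1 i).const_mul _
  have hint2 : ∀ a, Integrable (fun ω => ∑ i, ∑ j, W a i * W a j * (ε i ω * ε j ω)) P := fun a =>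
    integrable_finsetSum _ fun i _ => integrable_finsetSum _ fun j _ =>
      (integrable_mul_of_memLp_two hε2 i j).const_mul _
  have hint : ∀ a, Integrable (fun ω => b a * b a + ∑ i, 2 * b a * W a i * ε i ω +
        ∑ i, ∑ j, W a i * W a j * (ε i ω * ε j ω)) P := fun a =>
    ((integrable_const _).add (hint1 a)).add (hint2 a)
  rw [← ofReal_integral_eq_lintegral_ofReal _ (ae_of_all _ fun ω => by positivity)]
  · congr 1
    simp only [hexp]
    rw [integral_finsetSum _ fun a _ => hint a, dotProduct, Finset.mul_sum,
      ← Finset.sum_add_distrib]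
    refine Finset.sum_congr rfl fun a _ => ?_
    rw [integral_add (f := fun ω => b a * b a + ∑ i, 2 * b a * W a i * ε i ω)
      ((integrable_const _).add (hint1 a)) (hint2 a), integral_add (integrable_const _) (hint1 a),
      integral_finsetSum _ fun i _ => (hε1 i).const_mul _,
      integral_finsetSum _ fun i _ => integrable_finsetSum _ fun j _ =>
        (integrable_mul_of_memLp_two hε2 i j).const_mul _]
    have h3 : ∀ i, ∫ ω, ∑ j, W a i * W a j * (ε i ω * ε j ω) ∂P = σ ^ 2 * W a i ^ 2 := by
      intro i
      rw [integral_finsetSum _ fun j _ => (integrable_mul_of_memLp_two hε2 i j).const_mul _]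
      simp only [integral_const_mul, hεcov, mul_ite, mul_zero, Finset.sum_ite_eq, Finset.mem_univ,
        if_true]
      ring
    simp only [h3, integral_const_mul, hε0, mul_zero, Finset.sum_const_zero, integral_const,
      probReal_univ, one_smul, add_zero, Finset.mul_sum]
  · simp only [hexp]
    exact integrable_finsetSum _ fun a _ => hint a

end Noise

/-! ### Measurability in the features -/

section Measurability

open Matrix

variable {n d : ℕ}

lemma continuous_designMatrix :
    Continuous (designMatrix : (Fin n → EuclideanSpace ℝ (Fin d)) → Matrix (Fin n) (Fin d) ℝ) := by
  refine continuous_matrix fun i a => ?_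
  simp only [designMatrix, of_apply]
  fun_prop

lemma measurable_inv_apply {ι : Type*} [Fintype ι] [DecidableEq ι] {α : Type*} [TopologicalSpace α]
    [MeasurableSpace α] [OpensMeasurableSpace α] {M : α → Matrix ι ι ℝ} (hM : Continuous M)
    (a b : ι) : Measurable fun x => (M x)⁻¹ a b := by
  have h : (fun x => (M x)⁻¹ a b) = fun x => (M x).det⁻¹ * (M x).adjugate a b := by
    funext x
    rw [Matrix.inv_def, Ring.inverse_eq_inv, Matrix.smul_apply, smul_eq_mul]
  rw [h]
  exact hM.matrix_det.measurable.inv.mul (hM.matrix_adjugate.matrix_elem a b).measurable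

lemma measurable_designMatrix_apply (i : Fin n) (a : Fin d) :
    Measurable fun x : Fin n → EuclideanSpace ℝ (Fin d) => designMatrix x i a :=
  (continuous_designMatrix.matrix_elem i a).measurable

lemma measurable_pinv_mul_apply (M : Matrix (Fin n) (Fin n) ℝ) (a : Fin d) (i : Fin n) :
    Measurable fun x : Fin n → EuclideanSpace ℝ (Fin d) =>
      (((designMatrix x)ᵀ * designMatrix x)⁻¹ * (designMatrix x)ᵀ * M) a i := by
  have hinv : ∀ a b, Measurable fun x : Fin n → EuclideanSpace ℝ (Fin d) =>
      ((designMatrix x)ᵀ * designMatrix x)⁻¹ a b := fun a b =>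
    measurable_inv_apply (continuous_designMatrix.matrix_transpose.matrix_mul
      continuous_designMatrix) a b
  simp only [mul_apply (M := _ * _), mul_apply (M := _⁻¹), transpose_apply]
  exact Finset.measurable_fun_sum _ fun j _ => (Finset.measurable_fun_sum _ fun c _ =>
    (hinv _ _).mul (measurable_designMatrix_apply _ _)).mul_const _

lemma measurable_noiseMatrix_apply (𝓑 : Bagging n) (a : Fin d) (i : Fin n) :
    Measurable fun x : Fin n → EuclideanSpace ℝ (Fin d) => noiseMatrix 𝓑 x a i :=
  measurable_pinv_mul_apply _ a i

lemma measurable_biasVec_apply (𝓑 : Bagging n) (θ : EuclideanSpace ℝ (Fin d)) (a : Fin d) :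
    Measurable fun x : Fin n → EuclideanSpace ℝ (Fin d) => biasVec 𝓑 x θ a := by
  simp only [biasVec, mulVec, dotProduct, mul_apply (N := designMatrix _)]
  exact Finset.measurable_fun_sum _ fun b _ => (Finset.measurable_fun_sum _ fun j _ =>
    (measurable_pinv_mul_apply _ a j).mul (measurable_designMatrix_apply _ _)).mul_const _

lemma measurable_biasTerm (𝓑 : Bagging n) (θ : EuclideanSpace ℝ (Fin d)) :
    Measurable fun x : Fin n → EuclideanSpace ℝ (Fin d) => biasTerm 𝓑 x θ := by
  simp only [biasTerm_eq_dotProduct, dotProduct]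
  exact Finset.measurable_fun_sum _ fun a _ =>
    (measurable_biasVec_apply 𝓑 θ a).mul (measurable_biasVec_apply 𝓑 θ a)

lemma measurable_norm_sq_biasVec_add (𝓑 : Bagging n) (θ : EuclideanSpace ℝ (Fin d)) :
    Measurable fun z : (Fin n → EuclideanSpace ℝ (Fin d)) × (Fin n → ℝ) =>
      ‖WithLp.toLp 2 (biasVec 𝓑 z.1 θ + noiseMatrix 𝓑 z.1 *ᵥ z.2)‖ ^ 2 := by
  simp only [norm_toLp_sq, dotProduct, Pi.add_apply, mulVec]
  have h : ∀ a, Measurable fun z : (Fin n → EuclideanSpace ℝ (Fin d)) × (Fin n → ℝ) =>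
      biasVec 𝓑 z.1 θ a + ∑ i, noiseMatrix 𝓑 z.1 a i * z.2 i := fun a =>
    ((measurable_biasVec_apply 𝓑 θ a).comp measurable_fst).add
      (Finset.measurable_fun_sum _ fun i _ =>
        ((measurable_noiseMatrix_apply 𝓑 a i).comp measurable_fst).mul
          ((measurable_pi_apply i).comp measurable_snd))
  exact Finset.measurable_fun_sum _ fun a _ => (h a).mul (h a)

/-- A function that depends on the sample through a measurably chosen bagging is measurable as soon
as it is for every fixed bagging. -/
lemma measurable_of_forall_bagging {α β γ : Type*} [MeasurableSpace α] [MeasurableSpace β]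
    [MeasurableSpace γ] {𝓑 : α → Bagging n} (h𝓑 : ∀ Q, MeasurableSet {x | 𝓑 x = Q})
    {p : β → α} (hp : Measurable p) {f : Bagging n → β → γ} (hf : ∀ Q, Measurable (f Q)) :
    Measurable fun z => f (𝓑 (p z)) z := by
  let _ : MeasurableSpace (Bagging n) := ⊤
  have h1 : Measurable fun z : Bagging n × β => f z.1 z.2 :=
    measurable_from_prod_countable_right fun Q => hf Q
  have h2 : Measurable 𝓑 := measurable_to_countable' h𝓑
  exact h1.comp ((h2.comp hp).prodMk measurable_id)

end Measurability

/-! ### Concentration of the sample covariance -/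

section Covariance

open Matrix

variable {d : ℕ} {κ : ℝ} {ν : Measure (EuclideanSpace ℝ (Fin d))}

lemma inner_toEuclideanLin (A : Matrix (Fin d) (Fin d) ℝ) (u v : EuclideanSpace ℝ (Fin d)) :
    inner ℝ (Matrix.toEuclideanLin A u) v = (A *ᵥ (u : Fin d → ℝ)) ⬝ᵥ (v : Fin d → ℝ) := by
  simp [PiLp.inner_apply, dotProduct, mul_comm, Matrix.toEuclideanLin, Matrix.toLpLin_apply]

lemma memLp_two_apply (hκ : 0 < κ) (hν : IsSubgaussianLaw κ ν) (a : Fin d) :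
    MemLp (fun x : EuclideanSpace ℝ (Fin d) => x a) 2 ν := by
  rw [memLp_two_iff_integrable_sq (by fun_prop)]
  have h := hν (EuclideanSpace.single a 1) (by simp)
  have h' := integrable_of_lintegral_exp_div (by positivity) (by fun_prop)
    (fun x => sq_nonneg _) h
  simpa [EuclideanSpace.inner_single_left] using h'

lemma featureCov_dotProduct (hκ : 0 < κ) (hν : IsSubgaussianLaw κ ν)
    (u : EuclideanSpace ℝ (Fin d)) :
    (featureCov ν *ᵥ (u : Fin d → ℝ)) ⬝ᵥ (u : Fin d → ℝ) = ∫ x, (inner ℝ u x) ^ 2 ∂ν := by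
  have hint : ∀ a b, Integrable (fun x : EuclideanSpace ℝ (Fin d) => u a * u b * (x a * x b)) ν :=
    fun a b => ((memLp_two_apply hκ hν a).integrable_mul (memLp_two_apply hκ hν b)).const_mul _
  have h1 : ∀ x : EuclideanSpace ℝ (Fin d),
      (inner ℝ u x) ^ 2 = ∑ a, ∑ b, u a * u b * (x a * x b) := by
    intro x
    rw [sq, PiLp.inner_apply, Finset.sum_mul_sum]
    refine Finset.sum_congr rfl fun a _ => Finset.sum_congr rfl fun b _ => ?_
    simp only [RCLike.inner_apply, conj_trivial]
    ring
  simp only [h1]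
  rw [integral_finsetSum _ fun a _ => integrable_finsetSum _ fun b _ => hint a b]
  simp only [integral_finsetSum _ fun b _ => hint _ b, integral_const_mul, dotProduct, mulVec,
    featureCov, of_apply, Finset.sum_mul]
  refine Finset.sum_congr rfl fun a _ => Finset.sum_congr rfl fun b _ => ?_
  ring

lemma isPositive_featureCov (hκ : 0 < κ) (hν : IsSubgaussianLaw κ ν) :
    (Matrix.toEuclideanLin (featureCov ν)).IsPositive := by
  refine ⟨fun u v => ?_, fun u => ?_⟩
  · have hT : (featureCov ν)ᵀ = featureCov ν := by
      ext a b
      simp only [featureCov, transpose_apply, of_apply, mul_comm]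
    rw [inner_toEuclideanLin, real_inner_comm, inner_toEuclideanLin, mulVec_dotProduct, hT,
      dotProduct_comm]
  · rw [inner_toEuclideanLin, featureCov_dotProduct hκ hν]
    exact integral_nonneg fun x => sq_nonneg _

lemma sigmaMin_mul_le_integral (hκ : 0 < κ) (hν : IsSubgaussianLaw κ ν)
    (u : EuclideanSpace ℝ (Fin d)) :
    sigmaMin (featureCov ν) * ‖u‖ ^ 2 ≤ ∫ x, (inner ℝ u x) ^ 2 ∂ν := by
  have h := singularValues_mul_norm_sq_le_inner (isPositive_featureCov hκ hν) u
  rwa [inner_toEuclideanLin, featureCov_dotProduct hκ hν, finrank_euclideanSpace_fin] at h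

lemma sigmaMin_featureCov_le [IsProbabilityMeasure ν] (hd : 0 < d) (hκ : 0 < κ)
    (hν : IsSubgaussianLaw κ ν) : sigmaMin (featureCov ν) ≤ κ ^ 2 := by
  have hu : ‖(EuclideanSpace.single (⟨0, hd⟩ : Fin d) (1 : ℝ))‖ = 1 := by simp
  have h1 := sigmaMin_mul_le_integral hκ hν (EuclideanSpace.single (⟨0, hd⟩ : Fin d) (1 : ℝ))
  rw [hu, one_pow, mul_one] at h1
  exact h1.trans (integral_le_of_lintegral_exp_div (by positivity) (by fun_prop)
    (fun x => sq_nonneg _) (hν _ hu))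

lemma five_pow_mul_exp_le (d : ℕ) : (5 : ℝ) ^ d * Real.exp (-(3 * d)) ≤ Real.exp (-d) := by
  have h5 : (5 : ℝ) ≤ Real.exp 2 := by
    have h := Real.exp_one_gt_d9
    have : Real.exp 2 = Real.exp 1 ^ 2 := by rw [← Real.exp_nat_mul]; norm_num
    rw [this]; nlinarith
  calc (5 : ℝ) ^ d * Real.exp (-(3 * d)) ≤ Real.exp 2 ^ d * Real.exp (-(3 * d)) := by gcongr
    _ = Real.exp (-d) := by rw [← Real.exp_nat_mul, ← Real.exp_add]; ring_nf

variable {n : ℕ} {Ω : Type*} {mΩ : MeasurableSpace Ω} {P : Measure Ω}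
  {X : Fin n → Ω → EuclideanSpace ℝ (Fin d)}

lemma lintegral_exp_inner_sq_le (hν : IsSubgaussianLaw κ ν) (hX : ∀ i, Measurable (X i))
    (hlaw : ∀ i, P.map (X i) = ν) {u : EuclideanSpace ℝ (Fin d)} (hu : ‖u‖ = 1) (i : Fin n) :
    ∫⁻ ω, ENNReal.ofReal (Real.exp ((inner ℝ u (X i ω)) ^ 2 / κ ^ 2)) ∂P ≤ 2 := by
  have h := hν u hu
  rwa [← hlaw i, lintegral_map (by fun_prop) (hX i)] at h

variable [IsProbabilityMeasure P]

/-- Deviation of the sample second moment along a unit vector, at the scale `√(d n)`. The constant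
`14` makes the exponent `14² / 64 ≥ 3`, enough to absorb a union bound over `5 ^ d` vectors. -/
lemma measureReal_abs_sum_inner_sq_sub_ge_le (hn : 0 < n) (hκ : 0 < κ)
    (hν : IsSubgaussianLaw κ ν) (hX : ∀ i, Measurable (X i)) (hlaw : ∀ i, P.map (X i) = ν)
    (hind : iIndepFun X P) (hdn : 448 * √((d : ℝ) * n) ≤ n)
    {u : EuclideanSpace ℝ (Fin d)} (hu : ‖u‖ = 1) :
    P.real {ω | 14 * κ ^ 2 * √((d : ℝ) * n) ≤
      |∑ i, (inner ℝ u (X i ω)) ^ 2 - n * ∫ x, (inner ℝ u x) ^ 2 ∂ν|} ≤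
      2 * Real.exp (-(3 * d)) := by
  have hκ2 : 0 < κ ^ 2 := by positivity
  have hn' : (0 : ℝ) < n := by exact_mod_cast hn
  have hsq := Real.sq_sqrt (show (0 : ℝ) ≤ (d : ℝ) * n by positivity)
  have hr := Real.sqrt_nonneg ((d : ℝ) * n)
  have h := measureReal_abs_sum_ge_le (μ := P) (Z := fun i ω => (inner ℝ u (X i ω)) ^ 2)
    (s := 14 * κ ^ 2 * √((d : ℝ) * n)) hn hκ2 (fun i => by have := hX i; fun_prop)
    (fun i ω => sq_nonneg _) (lintegral_exp_inner_sq_le hν hX hlaw hu)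
    (hind.comp (fun _ x => (inner ℝ u x) ^ 2) fun _ => by fun_prop) (by positivity)
    (by nlinarith)
  have hmean : ∀ i, ∫ ω, (inner ℝ u (X i ω)) ^ 2 ∂P = ∫ x, (inner ℝ u x) ^ 2 ∂ν := fun i => by
    rw [← hlaw i, integral_map (hX i).aemeasurable (by fun_prop)]
  simp only [hmean, Finset.sum_sub_distrib, Finset.sum_const, Finset.card_univ, Fintype.card_fin,
    nsmul_eq_mul] at h
  refine h.trans ?_
  gcongr
  rw [mul_pow, mul_pow, hsq, le_div_iff₀ (by positivity)]
  have : (0 : ℝ) ≤ κ ^ 4 * n * d := by positivity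
  nlinarith

/-- With probability at least `1 - 2 exp (-d)`, the sample second moment matrix is bounded below by
`n σ_min(Σ) - 448 κ² √(d n)`, where `448 = 32 * 14` is the loss in passing from the net to the sphere
times the deviation on the net. -/
lemma exists_measurableSet_design_bounded_below [IsProbabilityMeasure ν] (hn : 0 < n) (hd : 0 < d)
    (hκ : 0 < κ) (hν : IsSubgaussianLaw κ ν) (hX : ∀ i, Measurable (X i))
    (hlaw : ∀ i, P.map (X i) = ν) (hind : iIndepFun X P)
    (hpos : 448 * κ ^ 2 * √((d : ℝ) * n) < n * sigmaMin (featureCov ν)) :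
    ∃ G : Set (Fin n → EuclideanSpace ℝ (Fin d)), MeasurableSet G ∧
      (∀ x ∈ G, ∀ v : Fin d → ℝ,
        (n * sigmaMin (featureCov ν) - 448 * κ ^ 2 * √((d : ℝ) * n)) * (v ⬝ᵥ v) ≤
          (designMatrix x *ᵥ v) ⬝ᵥ (designMatrix x *ᵥ v)) ∧
      P.real {ω | (fun i => X i ω) ∉ G} ≤ 2 * Real.exp (-d) := by
  have hκ2 : 0 < κ ^ 2 := by positivity
  have hn' : (0 : ℝ) < n := by exact_mod_cast hn
  have hdn : 448 * √((d : ℝ) * n) ≤ n := by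
    have h1 : (n : ℝ) * sigmaMin (featureCov ν) ≤ n * κ ^ 2 := by
      gcongr
      exact sigmaMin_featureCov_le hd hκ hν
    have h2 : κ ^ 2 * (448 * √((d : ℝ) * n)) ≤ κ ^ 2 * n := by linarith
    exact le_of_mul_le_mul_left h2 hκ2
  obtain ⟨N, hN1, hNcard, hN⟩ := exists_half_net_unitSphere (E := EuclideanSpace ℝ (Fin d))
  rw [finrank_euclideanSpace_fin] at hNcard
  set s := 14 * κ ^ 2 * √((d : ℝ) * n) with hs
  let D : EuclideanSpace ℝ (Fin d) → (Fin n → EuclideanSpace ℝ (Fin d)) → ℝ := fun u x =>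
    ∑ i, (inner ℝ u (x i)) ^ 2 - n * ∫ z, (inner ℝ u z) ^ 2 ∂ν
  refine ⟨{x | ∀ u ∈ N, |D u x| ≤ s}, ?_, ?_, ?_⟩
  · have : {x | ∀ u ∈ N, |D u x| ≤ s} = ⋂ u ∈ N, {x | |D u x| ≤ s} := by ext; simp
    rw [this]
    refine N.measurableSet_biInter fun u _ => measurableSet_le ?_ measurable_const
    simp only [D]
    fun_prop
  · intro x hx v
    set w : EuclideanSpace ℝ (Fin d) := WithLp.toLp 2 v with hw
    have hwv : ‖w‖ ^ 2 = v ⬝ᵥ v := norm_toLp_sq v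
    set A := (designMatrix x)ᵀ * designMatrix x - (n : ℝ) • featureCov ν with hA
    have hXw : ∀ u : EuclideanSpace ℝ (Fin d), (designMatrix x *ᵥ (u : Fin d → ℝ)) ⬝ᵥ
        (designMatrix x *ᵥ (u : Fin d → ℝ)) = ∑ i, (inner ℝ u (x i)) ^ 2 := fun u => by
      rw [dotProduct]
      refine Finset.sum_congr rfl fun i _ => ?_
      rw [designMatrix_mulVec, real_inner_comm, sq]
    have hD : ∀ u, inner ℝ ((Matrix.toEuclideanLin A).toContinuousLinearMap u) u = D u x := by
      intro u
      rw [LinearMap.coe_toContinuousLinearMap', inner_toEuclideanLin, hA, sub_mulVec, smul_mulVec,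
        sub_dotProduct, smul_dotProduct, featureCov_dotProduct hκ hν, ← mulVec_mulVec,
        mulVec_dotProduct, transpose_transpose, hXw, smul_eq_mul]
    have h1 := abs_inner_le_of_forall_net (Matrix.toEuclideanLin A).toContinuousLinearMap hN1 hN
      (s := s) (fun u hu => by rw [hD]; exact hx u hu) w
    rw [hD] at h1
    have h2 := sigmaMin_mul_le_integral hκ hν w
    have h3 := hXw w
    have h4 : (n : ℝ) * (sigmaMin (featureCov ν) * ‖w‖ ^ 2) ≤ n * ∫ z, (inner ℝ w z) ^ 2 ∂ν := by
      gcongr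
    have h5 := (abs_le.1 h1).1
    simp only [D] at h5
    rw [← hwv]
    show _ ≤ (designMatrix x *ᵥ (w : Fin d → ℝ)) ⬝ᵥ (designMatrix x *ᵥ (w : Fin d → ℝ))
    rw [h3]
    have h6 : 32 * s * ‖w‖ ^ 2 = 448 * κ ^ 2 * √((d : ℝ) * n) * ‖w‖ ^ 2 := by rw [hs]; ring
    linarith
  · calc P.real {ω | (fun i => X i ω) ∉ {x | ∀ u ∈ N, |D u x| ≤ s}}
        ≤ P.real (⋃ u ∈ N, {ω | s ≤ |D u fun i => X i ω|}) := by
          refine measureReal_mono (fun ω hω => ?_) (measure_ne_top _ _)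
          simp only [Set.mem_ofPred_eq, not_forall, not_le] at hω
          obtain ⟨u, hu, hω⟩ := hω
          exact Set.mem_biUnion hu hω.le
      _ ≤ ∑ u ∈ N, P.real {ω | s ≤ |D u fun i => X i ω|} := measureReal_biUnion_finset_le _ _
      _ ≤ ∑ _u ∈ N, 2 * Real.exp (-(3 * d)) := Finset.sum_le_sum fun u hu =>
          measureReal_abs_sum_inner_sq_sub_ge_le hn hκ hν hX hlaw hind hdn (hN1 u hu)
      _ = N.card * (2 * Real.exp (-(3 * d))) := by rw [Finset.sum_const, nsmul_eq_mul]
      _ ≤ (5 : ℝ) ^ d * (2 * Real.exp (-(3 * d))) := by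
          gcongr
          exact_mod_cast hNcard
      _ ≤ 2 * Real.exp (-d) := by linarith [five_pow_mul_exp_le d]

/-- The largest of the true means is of order `κ ‖θ‖ √(log n)`. -/
lemma measureReal_exists_inner_sq_gt_le (hn : 2 ≤ n) (hκ : 0 < κ) (hν : IsSubgaussianLaw κ ν)
    (hX : ∀ i, Measurable (X i)) (hlaw : ∀ i, P.map (X i) = ν) (θ : EuclideanSpace ℝ (Fin d)) :
    P.real {ω | ∃ i, 4 * κ ^ 2 * ‖θ‖ ^ 2 * Real.log n < (inner ℝ (X i ω) θ) ^ 2} ≤ 1 / n := by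
  have hn' : (2 : ℝ) ≤ n := by exact_mod_cast hn
  rcases eq_or_ne θ 0 with rfl | hθ
  · simp
  have hθ' : 0 < ‖θ‖ := norm_pos_iff.2 hθ
  set u := ‖θ‖⁻¹ • θ with hu
  have hu1 : ‖u‖ = 1 := by simp [hu, norm_smul, hθ]
  have hθu : θ = ‖θ‖ • u := by rw [hu, smul_smul, mul_inv_cancel₀ hθ'.ne', one_smul]
  calc P.real {ω | ∃ i, 4 * κ ^ 2 * ‖θ‖ ^ 2 * Real.log n < (inner ℝ (X i ω) θ) ^ 2}
      ≤ P.real (⋃ i, {ω | κ ^ 2 * (4 * Real.log n) < (inner ℝ u (X i ω)) ^ 2}) := by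
        refine measureReal_mono (fun ω hω => ?_) (measure_ne_top _ _)
        obtain ⟨i, hi⟩ := hω
        refine Set.mem_iUnion.2 ⟨i, ?_⟩
        have h1 : (inner ℝ (X i ω) θ) ^ 2 = ‖θ‖ ^ 2 * (inner ℝ u (X i ω)) ^ 2 := by
          conv_lhs => rw [hθu, inner_smul_right, real_inner_comm, mul_pow]
        rw [h1] at hi
        have h2 : ‖θ‖ ^ 2 * (κ ^ 2 * (4 * Real.log n)) < ‖θ‖ ^ 2 * (inner ℝ u (X i ω)) ^ 2 := by
          linarith
        exact lt_of_mul_lt_mul_left h2 (by positivity)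
    _ ≤ ∑ i, P.real {ω | κ ^ 2 * (4 * Real.log n) < (inner ℝ u (X i ω)) ^ 2} :=
        measureReal_iUnion_fintype_le _
    _ ≤ ∑ _i : Fin n, 2 * Real.exp (-(4 * Real.log n)) := Finset.sum_le_sum fun i _ =>
        measureReal_lt_le_of_lintegral_exp_div (by have := hX i; fun_prop)
          (lintegral_exp_inner_sq_le hν hX hlaw hu1 i) (by positivity) _
    _ ≤ 1 / n := by
        have h1 : Real.exp (-(4 * Real.log n)) = 1 / (n : ℝ) ^ 4 := by
          rw [Real.exp_neg, one_div]
          congr 1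
          have : 4 * Real.log n = ((4 : ℕ) : ℝ) * Real.log n := by norm_num
          rw [this, Real.exp_nat_mul, Real.exp_log (by linarith)]
        rw [Finset.sum_const, Finset.card_univ, Fintype.card_fin, nsmul_eq_mul, h1]
        have h2 : (n : ℝ) * (2 * (1 / (n : ℝ) ^ 4)) = 2 / (n : ℝ) ^ 2 * (1 / n) := by
          field_simp
        rw [h2]
        have h3 : 2 / (n : ℝ) ^ 2 ≤ 1 := by
          rw [div_le_one (by positivity)]
          nlinarith
        exact mul_le_of_le_one_left (by positivity) h3

end Covariance

/-! ### The risk bound -/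

section Risk

open Matrix

variable {n d : ℕ} {Ω : Type*} {mΩ : MeasurableSpace Ω} {P : Measure Ω} [IsProbabilityMeasure P]
  {X : Fin n → Ω → EuclideanSpace ℝ (Fin d)}

/-- Bias-variance bound for the conditional risk on the event that the design is bounded below. -/
lemma ae_condLExp_norm_sub_sq_le {σ : ℝ} {ε : Fin n → Ω → ℝ} {θstar : EuclideanSpace ℝ (Fin d)}
    {𝓑 : (Fin n → EuclideanSpace ℝ (Fin d)) → Bagging n} {θhat : Ω → EuclideanSpace ℝ (Fin d)}
    (hn : 0 < n) (hX : ∀ i, Measurable (X i)) (hεm : ∀ i, Measurable (ε i))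
    (hε2 : ∀ i, MemLp (ε i) 2 P) (hε0 : ∀ i, ∫ ω, ε i ω ∂P = 0)
    (hεcov : ∀ i j, ∫ ω, ε i ω * ε j ω ∂P = if i = j then σ ^ 2 else 0)
    (hXε : IndepFun (fun ω i => X i ω) (fun ω i => ε i ω) P)
    (h𝓑m : ∀ Q : Bagging n, MeasurableSet {x | 𝓑 x = Q})
    (hθ : ∀ᵐ ω ∂P, ∀ θ : EuclideanSpace ℝ (Fin d),
      eventLoss (𝓑 fun i => X i ω) (fun i => X i ω)
          (fun i => inner ℝ (X i ω) θstar + ε i ω) (θhat ω) ≤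
        eventLoss (𝓑 fun i => X i ω) (fun i => X i ω)
          (fun i => inner ℝ (X i ω) θstar + ε i ω) θ)
    {l : ℝ} (hl : 0 < l) {G : Set (Fin n → EuclideanSpace ℝ (Fin d))} (hG : MeasurableSet G)
    (hGl : ∀ x ∈ G, ∀ v : Fin d → ℝ,
      l * (v ⬝ᵥ v) ≤ (designMatrix x *ᵥ v) ⬝ᵥ (designMatrix x *ᵥ v)) :
    ∀ᵐ ω ∂P, (fun i => X i ω) ∈ G →
      condLExp (MeasurableSpace.comap (fun ω i => X i ω) inferInstance) P
          (fun ω => ENNReal.ofReal (‖θhat ω - θstar‖ ^ 2)) ω ≤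
        ENNReal.ofReal (biasTerm (𝓑 fun i => X i ω) (fun i => X i ω) θstar +
          σ ^ 2 * (min (𝓑 fun i => X i ω).parts.card d : ℕ) / l) := by
  refine ae_condLExp_comap_le_of_indepFun (X := fun ω i => X i ω) (Y := fun ω i => ε i ω)
    (F := fun z => ENNReal.ofReal (‖WithLp.toLp 2
      (biasVec (𝓑 z.1) z.1 θstar + noiseMatrix (𝓑 z.1) z.1 *ᵥ z.2)‖ ^ 2))
    (g := fun x => ENNReal.ofReal (biasTerm (𝓑 x) x θstar +
      σ ^ 2 * (min (𝓑 x).parts.card d : ℕ) / l))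
    (measurable_pi_lambda _ hX) (measurable_pi_lambda _ hεm) hXε ?_ ?_ hG ?_ ?_
  · exact (measurable_of_forall_bagging h𝓑m measurable_fst
      fun Q => measurable_norm_sq_biasVec_add Q θstar).ennreal_ofReal
  · exact (measurable_of_forall_bagging h𝓑m measurable_id
      (f := fun Q x => biasTerm Q x θstar + σ ^ 2 * (min Q.parts.card d : ℕ) / l)
      fun Q => (measurable_biasTerm Q θstar).add_const _).ennreal_ofReal
  · filter_upwards [hθ] with ω hω hωG
    rw [sub_eq_biasVec_add_noise hn hl (hGl _ hωG) hω]
  · intro x hx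
    show ∫⁻ ω, ENNReal.ofReal (‖WithLp.toLp 2 (biasVec (𝓑 x) x θstar +
      noiseMatrix (𝓑 x) x *ᵥ fun i => ε i ω)‖ ^ 2) ∂P ≤ _
    rw [lintegral_norm_sq_add_mulVec hε2 hε0 hεcov, ← biasTerm_eq_dotProduct, mul_div_assoc]
    gcongr
    exact sum_noiseMatrix_sq_le hl (hGl x hx) (𝓑 x)

end Risk

/-! ### The bound as the sample grows -/

lemma tendsto_biasBound_add_varianceBound (C κ σ t : ℝ) {s : ℝ} (hs : 0 < s) (d k : ℕ)
    (m : ℕ → ℕ) :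
    Tendsto (fun n : ℕ => biasBound C κ s t d k n + varianceBound C σ s d (m n) n)
      atTop (𝓝 0) := by
  have hinv : Tendsto (fun n : ℕ => (n : ℝ)⁻¹) atTop (𝓝 0) := tendsto_inv_atTop_nhds_zero_nat
  have hsqrt : Tendsto (fun n : ℕ => √((n : ℝ)⁻¹)) atTop (𝓝 0) := by
    simpa using hinv.sqrt
  have hlog : Tendsto (fun n : ℕ => Real.log n * (n : ℝ)⁻¹) atTop (𝓝 0) := by
    have h := (Real.isLittleO_log_id_atTop.tendsto_div_nhds_zero).comp
      (tendsto_natCast_atTop_atTop (R := ℝ))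
    simpa [Function.comp_def, div_eq_mul_inv] using h
  -- both denominators are `n` times a quantity that tends to `s`
  have hden : Tendsto (fun n : ℕ => s - C * √(d : ℝ) * √((n : ℝ)⁻¹)) atTop (𝓝 s) := by
    simpa using (hsqrt.const_mul (C * √(d : ℝ))).const_sub s
  have hmin : Tendsto (fun n : ℕ => ((min (m n) d : ℕ) : ℝ) * (n : ℝ)⁻¹) atTop (𝓝 0) := by
    refine squeeze_zero (fun n => by positivity) (fun n => ?_)
      (by simpa using hinv.const_mul (d : ℝ))
    have : ((min (m n) d : ℕ) : ℝ) ≤ d := by exact_mod_cast min_le_right _ _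
    gcongr
  have hlim := ((hlog.const_mul (8 * k * κ ^ 2 * t ^ 2)).add (hmin.const_mul (σ ^ 2))).div hden
    hs.ne'
  simp only [mul_zero, add_zero, zero_div] at hlim
  refine hlim.congr' ?_
  filter_upwards [eventually_gt_atTop 0] with n hn
  have hn' : (0 : ℝ) < n := by exact_mod_cast hn
  have h1 : (n : ℝ) * s - C * √((d : ℝ) * n) = n * (s - C * √(d : ℝ) * √((n : ℝ)⁻¹)) := by
    have h2 : √(n : ℝ) = n * √((n : ℝ)⁻¹) := by
      rw [Real.sqrt_inv, ← div_eq_mul_inv, Real.div_sqrt]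
    rw [Real.sqrt_mul (Nat.cast_nonneg d), h2]
    ring
  simp only [Pi.div_apply, biasBound, varianceBound]
  rw [h1, ← add_div, mul_comm (n : ℝ) (s - _), ← div_div, div_right_comm, add_div _ _ (n : ℝ)]
  simp only [div_eq_mul_inv, mul_assoc]

theorem mainTheorem4 (κ : ℝ) (hκ : 0 < κ) :
    ∃ c C : ℝ, 0 < c ∧ 0 < C ∧
      -- the high-probability bounds on the bias term and on the risk
      (∀ (n d k : ℕ) (_hk : 0 < k)
        (ν : Measure (EuclideanSpace ℝ (Fin d))) (_hν : IsProbabilityMeasure ν)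
        (_hsub : IsSubgaussianLaw κ ν)
        (_hpos : C * √((d : ℝ) * n) < n * sigmaMin (featureCov ν))
        (Ω : Type*) (mΩ : MeasurableSpace Ω) (P : Measure Ω) (_hP : IsProbabilityMeasure P)
        -- i.i.d. features with law `ν`
        (X : Fin n → Ω → EuclideanSpace ℝ (Fin d)) (_hXm : ∀ i, Measurable (X i))
        (_hXlaw : ∀ i, P.map (X i) = ν) (_hXind : iIndepFun X P)
        -- centered, uncorrelated noise of variance `σ²`, independent of the features
        (σ : ℝ) (ε : Fin n → Ω → ℝ) (_hεm : ∀ i, Measurable (ε i))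
        (_hε2 : ∀ i, MemLp (ε i) 2 P) (_hε0 : ∀ i, ∫ ω, ε i ω ∂P = 0)
        (_hεcov : ∀ i j, ∫ ω, ε i ω * ε j ω ∂P = if i = j then σ ^ 2 else 0)
        (_hXε : IndepFun (fun ω i => X i ω) (fun ω i => ε i ω) P)
        -- bags curated, as a function of the features, from the true means `X θ*`
        (θstar : EuclideanSpace ℝ (Fin d))
        (𝓑 : (Fin n → EuclideanSpace ℝ (Fin d)) → Bagging n)
        (_h𝓑m : ∀ Q : Bagging n, MeasurableSet {x | 𝓑 x = Q})
        (_h𝓑 : ∀ᵐ ω ∂P,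
          IsOptimalBagging k (fun i => inner ℝ (X i ω) θstar) (𝓑 fun i => X i ω) ∨
          IsSortedBagging k (fun i => inner ℝ (X i ω) θstar) (𝓑 fun i => X i ω))
        -- a minimizer of the event-level loss for the responses `y_i = ⟪x_i, θ*⟫ + ε_i`
        (θhat : Ω → EuclideanSpace ℝ (Fin d)) (_hθm : Measurable θhat)
        (_hθ : ∀ᵐ ω ∂P, ∀ θ : EuclideanSpace ℝ (Fin d),
          eventLoss (𝓑 fun i => X i ω) (fun i => X i ω)
              (fun i => inner ℝ (X i ω) θstar + ε i ω) (θhat ω) ≤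
            eventLoss (𝓑 fun i => X i ω) (fun i => X i ω)
              (fun i => inner ℝ (X i ω) θstar + ε i ω) θ),
        ∃ E : Set Ω, MeasurableSet E ∧
          1 - 1 / (n : ℝ) - 2 * Real.exp (-(c * d)) ≤ P.real E ∧
          ∀ ω ∈ E,
            IsUnit ((designMatrix fun i => X i ω).transpose *
              (designMatrix fun i => X i ω)).det ∧
            biasTerm (𝓑 fun i => X i ω) (fun i => X i ω) θstar ≤
              biasBound C κ (sigmaMin (featureCov ν)) ‖θstar‖ d k n ∧
            condLExp (MeasurableSpace.comap (fun ω i => X i ω) inferInstance) P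
                (fun ω => ENNReal.ofReal (‖θhat ω - θstar‖ ^ 2)) ω ≤
              ENNReal.ofReal
                (biasBound C κ (sigmaMin (featureCov ν)) ‖θstar‖ d k n +
                  varianceBound C σ (sigmaMin (featureCov ν)) d
                    (𝓑 fun i => X i ω).parts.card n)) ∧
      -- the bound on the risk does not grow with `n`: it vanishes in the limit
      (∀ (d k : ℕ) (σ s t : ℝ) (_hs : 0 < s) (m : ℕ → ℕ),
        Tendsto (fun n : ℕ => biasBound C κ s t d k n + varianceBound C σ s d (m n) n)
          atTop (𝓝 0)) := by 
  refine ⟨1, 448 * κ ^ 2, one_pos, by positivity, ?_, fun d k σ s t hs m =>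
    tendsto_biasBound_add_varianceBound _ κ σ t hs d k m⟩
  intro n d k hk ν hν hsub hpos Ω mΩ P hP X hX hlaw hind σ ε hεm hε2 hε0 hεcov hXε θstar 𝓑 h𝓑m h𝓑
    θhat hθm hθ
  have hn : 0 < n := by
    rcases Nat.eq_zero_or_pos n with rfl | h
    · simp at hpos
    · exact h
  have hd : 0 < d := by
    rcases Nat.eq_zero_or_pos d with rfl | h
    · have h0 : sigmaMin (featureCov ν) = 0 :=
        LinearMap.singularValues_of_finrank_le _ (by simp)
      simp [h0] at hpos
    · exact h
  rcases (show n = 1 ∨ 2 ≤ n by omega) with rfl | hn2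
  · -- for `n = 1` the claimed probability is negative
    refine ⟨∅, MeasurableSet.empty, ?_, by simp⟩
    simp only [Nat.cast_one, div_one, sub_self, measureReal_empty]
    linarith [Real.exp_pos (-(1 * (d : ℝ)))]
  set s := sigmaMin (featureCov ν) with hs
  set l := n * s - 448 * κ ^ 2 * √((d : ℝ) * n) with hl_def
  have hl : 0 < l := sub_pos.2 hpos
  obtain ⟨G, hGm, hGl, hGP⟩ :=
    exists_measurableSet_design_bounded_below hn hd hκ hsub hX hlaw hind hpos
  have hrisk := ae_condLExp_norm_sub_sq_le hn hX hεm hε2 hε0 hεcov hXε h𝓑m hθ hl hGm hGl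
  have hXm : Measurable fun ω i => X i ω := measurable_pi_lambda _ hX
  let B₁ : Set Ω := {ω | (fun i => X i ω) ∉ G}
  let B₂ : Set Ω :=
    {ω | ∃ i, 4 * κ ^ 2 * ‖θstar‖ ^ 2 * Real.log n < (inner ℝ (X i ω) θstar) ^ 2}
  have hB₁ : MeasurableSet B₁ := (hXm hGm).compl
  have hB₂ : MeasurableSet B₂ := by
    have : B₂ = ⋃ i, {ω | 4 * κ ^ 2 * ‖θstar‖ ^ 2 * Real.log n < (inner ℝ (X i ω) θstar) ^ 2} := by
      ext ω; simp [B₂]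
    rw [this]
    refine MeasurableSet.iUnion fun i => measurableSet_lt measurable_const ?_
    have := hX i
    fun_prop
  obtain ⟨B₀, hB₀sub, hB₀, hB₀P⟩ :=
    exists_measurable_superset_of_null (ae_iff.1 (hrisk.and h𝓑))
  refine ⟨(B₀ ∪ (B₁ ∪ B₂))ᶜ, (hB₀.union (hB₁.union hB₂)).compl, ?_, ?_⟩
  · rw [probReal_compl_eq_one_sub (hB₀.union (hB₁.union hB₂))]
    have h0 : P.real B₀ = 0 := by rw [measureReal_def, hB₀P, ENNReal.toReal_zero]
    have h1 := measureReal_union_le (μ := P) B₀ (B₁ ∪ B₂)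
    have h2 := measureReal_union_le (μ := P) B₁ B₂
    have h3 := measureReal_exists_inner_sq_gt_le hn2 hκ hsub hX hlaw θstar
    rw [one_mul]
    linarith
  · intro ω hω
    simp only [Set.mem_compl_iff, Set.mem_union, not_or] at hω
    obtain ⟨hω0, hω1, hω2⟩ := hω
    have hωG : (fun i => X i ω) ∈ G := not_not.1 hω1
    have hω0' := not_not.1 fun h => hω0 (hB₀sub h)
    obtain ⟨hωrisk, hωcur⟩ := hω0'
    have hlog : 0 ≤ Real.log n := Real.log_natCast_nonneg n
    have hmax : ∀ i, |inner ℝ (X i ω) θstar| ≤ √(4 * κ ^ 2 * ‖θstar‖ ^ 2 * Real.log n) := by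
      intro i
      refine Real.abs_le_sqrt (not_lt.1 fun h => hω2 ⟨i, h⟩)
    have hbias : biasTerm (𝓑 fun i => X i ω) (fun i => X i ω) θstar ≤
        biasBound (448 * κ ^ 2) κ s ‖θstar‖ d k n := by
      refine (biasTerm_le_baggingCost_div hl (hGl _ hωG) _ θstar).trans ?_
      rw [biasBound]
      gcongr
      refine (baggingCost_le_of_curated hk (Real.sqrt_nonneg _) hmax hωcur).trans_eq ?_
      rw [Real.sq_sqrt (by positivity)]
      ring
    refine ⟨isUnit_det_of_le hl (hGl _ hωG), hbias, (hωrisk hωG).trans ?_⟩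
    exact ENNReal.ofReal_le_ofReal (add_le_add hbias le_rfl)
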